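/- Let $d>k\ge 1$, $M\ge 2$, $K=[0,1]^d$, and let $\mathcal A_n$ be the set of $d\times n$ matrices with entries in $\{0,\dots,M-1\}$. For $A\in\mathcal A_n$ let $v_A=A\,(M^{-1},\dots,M^{-n})^T$, $\varphi_A(x)=M^{-n}x+v_A$ and $K_A=\varphi_A(K)$. Let $0<p_C<1$ for $C\in\mathcal A_1$. Let $E=\bigcap_n E_n$ be the fractal percolation set: $E_0=K$, and each retained cube $K_A$ of level $n$ is subdivided into the cubes $K_{(A|C)}$, $C\in\mathcal A_1$, which are retained independently of each other and of everything else, with probabilities $p_C$; $E_n$ is the union of the retained cubes of level $n$. For an orthonormal $k$-tuple $\alpha$ of vectors in $\mathbb R^d$ let $S_\alpha$ be its span, and let $\mathcal{C}$ be the set of those $\alpha$ for which $|\det C_2|>\frac{1}{2\sqrt{\binom dk}}$, where $C_2$ consists of the last $d-k$ rows of a $d\times(d-k)$ matrix whose columns form an orthonormal basis of $S_\alpha^\perp$. For $\alpha\in \mathcal{C}$ let $\Pi_\alpha$ be the linear projection of $\mathbb R^d$ along $S_\alpha^\perp$ onto $\mathbb R^k=\mathrm{span}\{e_1,\dots,e_k\}$,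 let $\Delta_\alpha=\Pi_\alpha(K)$, and for $f:\mathbb R^k\to[0,\infty)$ let $$F_\alpha f(x)=\sum_{C\in\mathcal A_1:\ x\in\Pi_\alpha(K_C)}p_C\, f\big(M(x-\Pi_\alpha v_C)\big).$$ Let $d(\alpha,\beta)$ be the minimum of $\max_i\|a'_i-b'_i\|$ over all orthonormal bases $(a'_i)$ of $S_\alpha$ and $(b'_i)$ of $S_\beta$. Let $I_1,I_2\subset\mathbb R^k$ be compact, $I_2\neq\emptyset$, let $r\ge 1$ be an integer, and let $J\subseteq \mathcal{C}$ be such that Condition $A(\alpha)$ holds for every $\alpha\in J$ with these same $I_1,I_2,r$, that is, for every $\alpha\in J$, $$I_1\subset\operatorname{int} I_2,\qquad I_2\subset\operatorname{int}\Delta_\alpha,\qquad F_\alpha^r\mathbf 1_{I_1}\ge 2\cdot\mathbf 1_{I_2}.$$ Let $\delta$ be the distance from $I_1$ to the complement of $I_2$. Let $C_R=C_R(J)>0$ be a constant such that for all $\alpha,\beta\in J$ and $\varepsilon>0$, $d(\alpha,\beta)<C_R\,\varepsilon$ implies $\|\Pi_\alpha x-\Pi_\beta x\|<\varepsilon$ for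 all $x\in K$. Let $\{S_t\}_{t\in T}$ be an almost linear family of projections, that is, for $t\in T$ and $x\in K$ one can choose $\alpha_t(x)$ with $S_t(x)=\Pi_{\alpha_t(x)}(x)$ such that (i) $\alpha_t(x)\in J$ for all $t\in T$, $x\in K$; (ii) $d(\alpha_t(x),\alpha_t(y))\le \frac{C_R\delta}{4}\|x-y\|$ for all $t\in T$, $x,y\in K$; (iii) for every $n\ge 1$ the set $T$ can be divided into subsets $Z^{(n)}_i$, whose number grows at most exponentially with $n$, such that $d(\alpha_t(x),\alpha_s(y))\le C_R M^{-nr}\delta/4$ whenever $t,s$ lie in the same $Z_i^{(n)}$ and $x,y$ lie in the same cube $K_A$, $A\in\mathcal A_{(n-1)r}$. Then almost surely, conditioned on $E\neq\emptyset$, the set $S_t(E)$ has nonempty interior (in $\mathbb R^k$) for all $t\in T$ simultaneously. -/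

import Mathlib

namespace FractalPercolation

open MeasureTheory

noncomputable section

/-! ### The cubes of the `M`-adic mesh -/

/-- `ℝ^d` with the Euclidean norm. -/
abbrev Space (d : ℕ) : Type := EuclideanSpace ℝ (Fin d)

/-- A `d × n` matrix with entries in `{0, …, M - 1}`, given by its columns: `A j` is the column
of level `j + 1`. These matrices label the mesh cubes of level `n`. -/
abbrev Word (d M n : ℕ) : Type := Fin n → Fin d → Fin M

/-- The closed unit cube `K = [0,1]^d`. -/
def unitCube (d : ℕ) : Set (Space d) := {x | ∀ i, 0 ≤ x i ∧ x i ≤ 1}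

/-- The lower corner `A (M⁻¹, …, M⁻ⁿ)ᵀ` of the cube with label `A`. -/
def corner {d M n : ℕ} (A : Word d M n) : Space d :=
  WithLp.toLp 2 fun i => ∑ j : Fin n, ((A j i : ℕ) : ℝ) / (M : ℝ) ^ ((j : ℕ) + 1)

/-- The homothety `φ_A` that maps the unit cube onto the cube with label `A`. -/
def phi {d M n : ℕ} (A : Word d M n) (x : Space d) : Space d :=
  ((M : ℝ) ^ n)⁻¹ • x + corner A

/-- The cube `K_A = φ_A(K)`. -/
def cube {d M n : ℕ} (A : Word d M n) : Set (Space d) := phi A '' unitCube d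

/-! ### Fractal percolation -/

/-- `keep ⟨n, B⟩` is the event that the cube `K_B` of level `n + 1` is not discarded at the
moment when its parent is subdivided. These events are independent, and the probability of
`keep ⟨n, B⟩` is the number `p C` given by the last column `C` of `B`. -/
structure IsPercolation {Ω : Type*} [MeasurableSpace Ω] (μ : Measure Ω) {d M : ℕ}
    (p : (Fin d → Fin M) → ℝ) (keep : (Σ n : ℕ, Word d M (n + 1)) → Set Ω) : Prop where
  measurableSet : ∀ w, MeasurableSet (keep w)
  prob : ∀ w, μ (keep w) = ENNReal.ofReal (p (w.2 (Fin.last w.1)))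
  indep : ProbabilityTheory.iIndepSet keep μ

/-- The labels of the retained cubes of level `n`: the unit cube is retained, and a cube of
level `n + 1` is retained if its parent is retained and it is itself kept. -/
def retained {Ω : Type*} {d M : ℕ} (keep : (Σ n : ℕ, Word d M (n + 1)) → Set Ω) (ω : Ω) :
    (n : ℕ) → Set (Word d M n)
  | 0 => Set.univ
  | n + 1 => {B | (Fin.init B : Word d M n) ∈ retained keep ω n ∧ ω ∈ keep ⟨n, B⟩}

/-- The fractal percolation set `E = ⋂ₙ Eₙ`, where `Eₙ` is the union of the retained cubes
of level `n`. -/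
def limitSet {Ω : Type*} {d M : ℕ} (keep : (Σ n : ℕ, Word d M (n + 1)) → Set Ω) (ω : Ω) :
    Set (Space d) :=
  ⋂ n : ℕ, ⋃ A ∈ retained keep ω n, cube A

/-! ### Directions and linear projections; the ambient space is `ℝ^(k+m)`, i.e. `d = k + m` -/

/-- Orthonormal `k`-tuples of vectors of `ℝ^d`. -/
abbrev Frame (d k : ℕ) : Type := {a : Fin k → Space d // Orthonormal ℝ a}

/-- The `k`-dimensional plane `S_α` spanned by the tuple `α`. -/
def plane {d k : ℕ} (a : Frame d k) : Submodule ℝ (Space d) :=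
  Submodule.span ℝ (Set.range a.1)

/-- The distance `d(α, β)`: the minimum, over orthonormal bases `a'` of `S_α` and `b'` of `S_β`,
of `max_i ‖a'_i - b'_i‖` (the distance on `Fin k → Space d` is this maximum). -/
def frameDist {d k : ℕ} (a b : Frame d k) : ℝ :=
  sInf {ρ : ℝ | ∃ a' b' : Frame d k, plane a' = plane a ∧ plane b' = plane b ∧
    ρ = dist a'.1 b'.1}

/-- The inclusion of `ℝ^k` in `ℝ^(k+m)` as the span of the first `k` coordinate vectors. -/
def incl (k m : ℕ) (y : Space k) : Space (k + m) :=
  WithLp.toLp 2 (Fin.append (fun i => y i) (fun _ : Fin m => (0 : ℝ)))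

/-- The tuples `α` for which the last `m` rows of a matrix whose columns form an orthonormal
basis of `S_αᗮ` have a determinant of absolute value more than `1 / (2 √(d choose k))`. (This
absolute value does not depend on the basis.) -/
def chart (k m : ℕ) : Set (Frame (k + m) k) :=
  {a | ∃ c : Fin m → Space (k + m), Orthonormal ℝ c ∧
    Submodule.span ℝ (Set.range c) = (plane a)ᗮ ∧
    1 / (2 * Real.sqrt ((k + m).choose k)) <
      |(Matrix.of fun i j : Fin m => c j (Fin.natAdd k i)).det|}

/-- The linear projection `Π_α` along `S_αᗮ` to the span of the first `k` coordinate vectors: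
`Π_α(x)` is the point of `(S_αᗮ + x) ∩ ℝ^k`, which is unique for `α` in the chart. -/
def planeProj {k m : ℕ} (a : Frame (k + m) k) (x : Space (k + m)) : Space k :=
  Classical.epsilon fun y : Space k => incl k m y - x ∈ (plane a)ᗮ

/-- `Δ_α = Π_α(K)`. -/
def shadow {k m : ℕ} (a : Frame (k + m) k) : Set (Space k) :=
  planeProj a '' unitCube (k + m)

/-! ### Condition A -/

/-- `ψ_{α,A}`, the inverse of `y ↦ Π_α(φ_A(y)) = M⁻ⁿ y + Π_α(corner A)` on `ℝ^k`. -/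
def psi {k m M n : ℕ} (a : Frame (k + m) k) (A : Word (k + m) M n) (x : Space k) : Space k :=
  (M : ℝ) ^ n • (x - planeProj a (corner A))

open Classical in
/-- The operator `F_α f(x) = ∑ p_C f(ψ_{α,C}(x))`, the sum being over the labels `C` of level `1`
with `x ∈ Π_α(K_C)`. -/
def opF {k m M : ℕ} (p : (Fin (k + m) → Fin M) → ℝ) (a : Frame (k + m) k)
    (f : Space k → ℝ) (x : Space k) : ℝ :=
  ∑ C : Fin (k + m) → Fin M,
    if x ∈ planeProj a '' cube (fun _ : Fin 1 => C) then
      p C * f (psi a (fun _ : Fin 1 => C) x) else 0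

/-- Condition `A(α)` is satisfied with the sets `I₁`, `I₂` and the iterate `r`. -/
structure ConditionA {k m M : ℕ} (p : (Fin (k + m) → Fin M) → ℝ) (I₁ I₂ : Set (Space k)) (r : ℕ)
    (a : Frame (k + m) k) : Prop where
  subset₁ : I₁ ⊆ interior I₂
  subset₂ : I₂ ⊆ interior (shadow a)
  ineq : ∀ x, 2 * I₂.indicator (fun _ => (1 : ℝ)) x ≤
    (opF p a)^[r] (I₁.indicator fun _ => (1 : ℝ)) x

/-- The width of the collar between `I₁` and the boundary of `I₂`: the largest `δ` such that the
open `δ`-neighbourhood of `I₁` is contained in `I₂`. -/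
def gap {k : ℕ} (I₁ I₂ : Set (Space k)) : ℝ :=
  sInf {ρ : ℝ | ∃ x ∈ I₁, ∃ y ∈ I₂ᶜ, ρ = dist x y}

/-- `c` is a robustness constant for the set `J` of directions. -/
def IsRobustnessConst {k m : ℕ} (J : Set (Frame (k + m) k)) (c : ℝ) : Prop :=
  0 < c ∧ ∀ a ∈ J, ∀ b ∈ J, ∀ ε : ℝ, 0 < ε → frameDist a b < c * ε →
    ∀ x ∈ unitCube (k + m), ‖planeProj a x - planeProj b x‖ < ε

/-! ### Almost linear families -/

/-- `α` exhibits `(S_t)` as an almost linear family of projections, relative to the set `J` of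
directions, the robustness constant `c`, the collar width `δ` and the iterate `r`. -/
structure IsAlmostLinear {T : Type*} {k m : ℕ} (M : ℕ) (J : Set (Frame (k + m) k)) (c δ : ℝ)
    (r : ℕ) (S : T → Space (k + m) → Space k) (α : T → Space (k + m) → Frame (k + m) k) :
    Prop where
  eq_proj : ∀ t, ∀ x ∈ unitCube (k + m), S t x = planeProj (α t x) x
  mem : ∀ t, ∀ x ∈ unitCube (k + m), α t x ∈ J
  lipschitz : ∀ t, ∀ x ∈ unitCube (k + m), ∀ y ∈ unitCube (k + m),
    frameDist (α t x) (α t y) ≤ c * δ / 4 * dist x y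
  /-- For each `n` the parameter set is divided into at most `C * b ^ n` classes (the fibres
  of `Z`). For parameters in a class and points in a cube of level `n * r`, the directions
  agree up to an error which is adapted to the cubes of the next level `(n + 1) * r`. -/
  partition : ∃ C b : ℕ, ∀ n : ℕ, ∃ Z : T → Fin (C * b ^ n), ∀ t s, Z t = Z s →
    ∀ A : Word (k + m) M (n * r), ∀ x ∈ cube A, ∀ y ∈ cube A,
      frameDist (α t x) (α s y) ≤ c * ((M : ℝ) ^ ((n + 1) * r))⁻¹ * δ / 4

end

end FractalPercolation

section

/-! Observed at levels divisible by `r`, the percolation is a branching tree. Call a cube `B`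
relevant to a pair `(t, y)` if `psi (α t (corner B)) B y ∈ I₂`. Condition A says that a relevant
cube has, in the mean, at least two surviving successors for which `y` lands in the smaller set
`I₁`. The collar between `I₁` and `I₂` absorbs errors: these successors are relevant to all nearby
points and to all parameters of the same class (`mem_relevant_of_mem_successors`). So in generation
`j` finitely many pairs need watching, exponentially many in `j`. By Hoeffding, a pair with at least
`(3/2)^j` surviving relevant cubes fails to pass on `(3/2)^(j+1)` of them with probability at most
`exp (-κ (3/2)^j)`, which beats the number of pairs. After a start in which everything survives,
growth for all followed pairs has probability at least `q > 0`, uniformly in the starting cube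
(`exists_le_measureReal_growth`).

Uniformity meets one obstacle: the number of classes grows with the absolute level. Below a cube of
level `N` only one parameter `t` is therefore followed at first, and its whole class only from level
`2N` on; then `N + j ≤ 2j`, and the count is exponential in `j` alone (`inherits_followed`).

For all parameters at once, take representatives of the classes of index `2n`. Growth for one fixed
parameter supplies `(3/2)^j` surviving cubes, each an independent trial for every representative, so
for a suitable `j` all succeed with probability at least `q/2`. Lévy's zero-one law makes this
almost sure on survival (`ae_exists_allTasks`). Given `t`, the cube `B` of its representative
yields, for all `y` in an open set, retained relevant cubes of all large levels, and compactness
gives `y ∈ S t '' E` (`mem_image_limitSet`). -/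

open MeasureTheory ProbabilityTheory Filter Topology

/-! ### Random trees: survival and its measurability -/

/-- A random tree in which the offspring of different vertices are independent: `keep w` is the
event that `w` survives given that its parent does. -/
structure BranchingTree {Ω : Type*} [MeasurableSpace Ω] (μ : Measure Ω) (V : Type*) where
  lvl : V → ℕ
  par : V → V
  level : ℕ → Finset V
  mem_level : ∀ n v, v ∈ level n ↔ lvl v = n
  keep : V → Set Ω
  -- The information in the offspring of a vertex. Survival of `w` belongs to its parent, so
  -- siblings may be dependent.
  sigma : V → MeasurableSpace Ω
  sigma_le : ∀ v, sigma v ≤ ‹MeasurableSpace Ω›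
  indep : iIndep sigma μ
  measurableSet_keep : ∀ v, lvl v ≠ 0 → MeasurableSet[sigma (par v)] (keep v)
  bound : ℕ
  card_le : ∀ v (S : Finset V), (∀ w ∈ S, lvl w = lvl v + 1 ∧ par w = v) → S.card ≤ bound
  lower : ℝ
  lower_pos : 0 < lower
  lower_le : ∀ v, lower ≤ μ.real (⋂ w ∈ {w | lvl w = lvl v + 1 ∧ par w = v}, keep w)

namespace BranchingTree

variable {Ω : Type*} [MeasurableSpace Ω] {μ : Measure Ω} {V : Type*}

section Deterministic

variable (𝒯 : BranchingTree μ V)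

open Classical in
noncomputable def children (v : V) : Finset V := (𝒯.level (𝒯.lvl v + 1)).filter fun w => 𝒯.par w = v

theorem mem_children {v w : V} : w ∈ 𝒯.children v ↔ 𝒯.lvl w = 𝒯.lvl v + 1 ∧ 𝒯.par w = v := by
  simp [children, 𝒯.mem_level]

theorem card_children_le (v : V) : (𝒯.children v).card ≤ 𝒯.bound :=
  𝒯.card_le v _ fun _ => 𝒯.mem_children.1

theorem lower_le_children (v : V) : 𝒯.lower ≤ μ.real (⋂ w ∈ 𝒯.children v, 𝒯.keep w) := by
  simpa only [mem_children, Set.mem_ofPred_eq] using 𝒯.lower_le v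

theorem measurableSet_keep_of_mem {v w : V} (h : w ∈ 𝒯.children v) :
    MeasurableSet[𝒯.sigma v] (𝒯.keep w) := by
  obtain ⟨h1, rfl⟩ := 𝒯.mem_children.1 h
  exact 𝒯.measurableSet_keep w (by omega)

open Classical in
/-- All the vertices that lie `j` generations below a vertex. -/
noncomputable def desc (A : V) : ℕ → Finset V
  | 0 => {A}
  | j + 1 => (desc A j).biUnion 𝒯.children

open Classical in
/-- The surviving vertices `j` generations below a vertex. -/
noncomputable def alive (A : V) (ω : Ω) : ℕ → Finset V
  | 0 => {A}
  | j + 1 => (alive A ω j).biUnion fun v => (𝒯.children v).filter fun w => ω ∈ 𝒯.keep w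

theorem mem_desc_succ {A w : V} {j : ℕ} :
    w ∈ 𝒯.desc A (j + 1) ↔ ∃ v ∈ 𝒯.desc A j, w ∈ 𝒯.children v := by
  simp [desc]

theorem mem_alive_succ {A w : V} {ω : Ω} {j : ℕ} :
    w ∈ 𝒯.alive A ω (j + 1) ↔ ∃ v ∈ 𝒯.alive A ω j, w ∈ 𝒯.children v ∧ ω ∈ 𝒯.keep w := by
  simp [alive]

theorem alive_subset_desc (A : V) (ω : Ω) (j : ℕ) : 𝒯.alive A ω j ⊆ 𝒯.desc A j := by
  induction j with
  | zero => simp [alive, desc]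
  | succ j ih =>
    intro w hw
    obtain ⟨v, hv, hw, -⟩ := 𝒯.mem_alive_succ.1 hw
    exact 𝒯.mem_desc_succ.2 ⟨v, ih hv, hw⟩

theorem lvl_of_mem_desc {A v : V} {j : ℕ} (h : v ∈ 𝒯.desc A j) : 𝒯.lvl v = 𝒯.lvl A + j := by
  induction j generalizing v with
  | zero => simp_all [desc]
  | succ j ih =>
    obtain ⟨u, hu, hv⟩ := 𝒯.mem_desc_succ.1 h
    rw [(𝒯.mem_children.1 hv).1, ih hu]; rfl

theorem iterate_par_of_mem_desc {A v : V} {j : ℕ} (h : v ∈ 𝒯.desc A j) : 𝒯.par^[j] v = A := by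
  induction j generalizing v with
  | zero => simp_all [desc]
  | succ j ih =>
    obtain ⟨u, hu, hv⟩ := 𝒯.mem_desc_succ.1 h
    rw [Function.iterate_succ_apply, (𝒯.mem_children.1 hv).2, ih hu]

theorem card_desc_le (A : V) (j : ℕ) : (𝒯.desc A j).card ≤ 𝒯.bound ^ j := by
  classical
  induction j with
  | zero => simp [desc]
  | succ j ih =>
    rw [pow_succ]
    have : (𝒯.desc A (j + 1)).card ≤ (𝒯.desc A j).card * 𝒯.bound := by
      rw [desc]
      exact Finset.card_biUnion_le_card_mul _ _ _ fun v _ => 𝒯.card_children_le v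
    exact this.trans (Nat.mul_le_mul_right _ ih)

theorem alive_add {A B C : V} {ω : Ω} {i j : ℕ} (hB : B ∈ 𝒯.alive A ω i)
    (hC : C ∈ 𝒯.alive B ω j) : C ∈ 𝒯.alive A ω (i + j) := by
  induction j generalizing C with
  | zero => simp_all [alive]
  | succ j ih =>
    obtain ⟨v, hv, h⟩ := 𝒯.mem_alive_succ.1 hC
    exact 𝒯.mem_alive_succ.2 ⟨v, ih hv, h⟩

def below (A : V) : Set V := {v | ∃ j, v ∈ 𝒯.desc A j}

/-- The offspring of generations strictly before `j` determine who is alive in generation `j`, and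
are independent of the offspring of generation `j` itself. -/
def belowLT (A : V) (j : ℕ) : Set V := {v | ∃ i < j, v ∈ 𝒯.desc A i}

theorem belowLT_subset_below (A : V) (j : ℕ) : 𝒯.belowLT A j ⊆ 𝒯.below A :=
  fun _ ⟨i, _, h⟩ => ⟨i, h⟩

theorem lvl_lt_of_mem_belowLT {A v : V} {j : ℕ} (h : v ∈ 𝒯.belowLT A j) :
    𝒯.lvl v < 𝒯.lvl A + j := by
  obtain ⟨i, hi, h⟩ := h
  rw [𝒯.lvl_of_mem_desc h]; omega

theorem lvl_le_of_mem_below {A v : V} (h : v ∈ 𝒯.below A) : 𝒯.lvl A ≤ 𝒯.lvl v := by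
  obtain ⟨i, h⟩ := h
  rw [𝒯.lvl_of_mem_desc h]; omega

theorem belowLT_mono (A : V) {i j : ℕ} (h : i ≤ j) : 𝒯.belowLT A i ⊆ 𝒯.belowLT A j :=
  fun _ ⟨l, hl, hv⟩ => ⟨l, by omega, hv⟩

theorem below_subset_of_mem_desc {A B : V} {j : ℕ} (h : B ∈ 𝒯.desc A j) :
    𝒯.below B ⊆ 𝒯.below A := by
  rintro v ⟨i, hv⟩
  refine ⟨j + i, ?_⟩
  induction i generalizing v with
  | zero => simp_all [desc]
  | succ i ih =>
    obtain ⟨u, hu, hv⟩ := 𝒯.mem_desc_succ.1 hv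
    exact 𝒯.mem_desc_succ.2 ⟨u, ih hu, hv⟩

theorem disjoint_below {A B : V} (hl : 𝒯.lvl A = 𝒯.lvl B) (hne : A ≠ B) :
    Disjoint (𝒯.below A) (𝒯.below B) := by
  rw [Set.disjoint_left]
  rintro v ⟨i, hi⟩ ⟨j, hj⟩
  have h1 := 𝒯.lvl_of_mem_desc hi
  have h2 := 𝒯.lvl_of_mem_desc hj
  obtain rfl : i = j := by omega
  exact hne ((𝒯.iterate_par_of_mem_desc hi).symm.trans (𝒯.iterate_par_of_mem_desc hj))

/-- The information contained in the offspring of the vertices of a set. -/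
@[reducible] def sigmaOn (S : Set V) : MeasurableSpace Ω := ⨆ v ∈ S, 𝒯.sigma v

theorem sigmaOn_le (S : Set V) : 𝒯.sigmaOn S ≤ ‹MeasurableSpace Ω› :=
  iSup₂_le fun v _ => 𝒯.sigma_le v

theorem sigmaOn_mono {S T : Set V} (h : S ⊆ T) : 𝒯.sigmaOn S ≤ 𝒯.sigmaOn T :=
  biSup_mono fun _ hv => h hv

theorem sigma_le_sigmaOn {S : Set V} {v : V} (h : v ∈ S) : 𝒯.sigma v ≤ 𝒯.sigmaOn S :=
  le_biSup 𝒯.sigma h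

theorem measurableSet_mem_alive (A v : V) (j : ℕ) :
    MeasurableSet[𝒯.sigmaOn (𝒯.belowLT A j)] {ω | v ∈ 𝒯.alive A ω j} := by
  induction j generalizing v with
  | zero => simp [alive]
  | succ j ih =>
    by_cases h : v ∈ 𝒯.desc A (j + 1)
    · obtain ⟨u, hu, hv⟩ := 𝒯.mem_desc_succ.1 h
      have : {ω | v ∈ 𝒯.alive A ω (j + 1)} = {ω | u ∈ 𝒯.alive A ω j} ∩ 𝒯.keep v := by
        ext ω
        simp only [mem_alive_succ, Set.mem_ofPred_eq, Set.mem_inter_iff]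
        constructor
        · rintro ⟨u', hu', hv', hk⟩
          rw [← (𝒯.mem_children.1 hv).2, (𝒯.mem_children.1 hv').2]
          exact ⟨hu', hk⟩
        · rintro ⟨h1, h2⟩
          exact ⟨u, h1, hv, h2⟩
      rw [this]
      refine @MeasurableSet.inter _ (𝒯.sigmaOn _) _ _
        (𝒯.sigmaOn_mono (𝒯.belowLT_mono A j.le_succ) _ (ih u)) ?_
      exact 𝒯.sigma_le_sigmaOn (S := 𝒯.belowLT A (j + 1)) ⟨j, j.lt_succ_self, hu⟩ _
        (𝒯.measurableSet_keep_of_mem hv)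
    · have : {ω | v ∈ 𝒯.alive A ω (j + 1)} = ∅ := by
        ext ω
        simpa using fun hv => h (𝒯.alive_subset_desc _ _ _ hv)
      rw [this]
      exact @MeasurableSet.empty _ (𝒯.sigmaOn _)

theorem measurableSet_alive_eq (A : V) (j : ℕ) (R : Finset V) :
    MeasurableSet[𝒯.sigmaOn (𝒯.belowLT A j)] {ω | 𝒯.alive A ω j = R} := by
  classical
  by_cases hR : R ⊆ 𝒯.desc A j
  · have : {ω | 𝒯.alive A ω j = R} =
        ⋂ v ∈ 𝒯.desc A j, if v ∈ R then {ω | v ∈ 𝒯.alive A ω j} else {ω | v ∈ 𝒯.alive A ω j}ᶜ := by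
      ext ω
      simp only [Set.mem_ofPred_eq, Set.mem_iInter]
      constructor
      · rintro rfl v -
        split_ifs with h <;> simpa using h
      · intro h
        ext v
        by_cases hv : v ∈ 𝒯.desc A j
        · have := h v hv
          split_ifs at this with hvR <;> simp_all
        · exact ⟨fun h => absurd (𝒯.alive_subset_desc _ _ _ h) hv, fun h => absurd (hR h) hv⟩
    rw [this]
    refine @Finset.measurableSet_biInter _ _ (𝒯.sigmaOn _) _ _ fun v _ => ?_
    split_ifs
    · exact 𝒯.measurableSet_mem_alive A v j
    · exact @MeasurableSet.compl _ _ (𝒯.sigmaOn _) (𝒯.measurableSet_mem_alive A v j)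
  · have : {ω | 𝒯.alive A ω j = R} = ∅ := by
      ext ω
      simp only [Set.mem_ofPred_eq, Set.mem_empty_iff_false, iff_false]
      rintro rfl
      exact hR (𝒯.alive_subset_desc _ _ _)
    rw [this]
    exact @MeasurableSet.empty _ (𝒯.sigmaOn _)

/-- `alive` takes only finitely many values, the subsets of `desc`, so `Φ` needs no regularity. -/
theorem measurableSet_alive (A : V) (j : ℕ) (Φ : Finset V → Prop) :
    MeasurableSet[𝒯.sigmaOn (𝒯.belowLT A j)] {ω | Φ (𝒯.alive A ω j)} := by
  classical
  have : {ω | Φ (𝒯.alive A ω j)} =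
      ⋃ R ∈ (𝒯.desc A j).powerset.filter Φ, {ω | 𝒯.alive A ω j = R} := by
    ext ω
    simp only [Set.mem_ofPred_eq, Set.mem_iUnion, Finset.mem_filter, Finset.mem_powerset]
    exact ⟨fun h => ⟨_, ⟨𝒯.alive_subset_desc _ _ _, h⟩, rfl⟩, by rintro ⟨R, ⟨-, h⟩, rfl⟩; exact h⟩
  rw [this]
  exact @Finset.measurableSet_biUnion _ _ (𝒯.sigmaOn _) _ _ fun R _ => 𝒯.measurableSet_alive_eq A j R

end Deterministic

/-! ### Independence of disjoint parts of the tree -/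

section Independence

variable (𝒯 : BranchingTree μ V)

theorem measureReal_inter {S T : Set V} (hST : Disjoint S T) {E F : Set Ω}
    (hE : MeasurableSet[𝒯.sigmaOn S] E) (hF : MeasurableSet[𝒯.sigmaOn T] F) :
    μ.real (E ∩ F) = μ.real E * μ.real F := by
  have h := indep_iSup_of_disjoint 𝒯.sigma_le 𝒯.indep hST
  have := (Indep_iff _ _ μ).1 h E F hE hF
  rw [measureReal_def, this, ENNReal.toReal_mul]; rfl

/-- Induction on `R`: each new event is absorbed into `E`, and its vertices into `S₀`. -/
theorem measureReal_inter_biInter {ι : Type*} (R : Finset ι) (S : ι → Set V) (S₀ : Set V)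
    (hS : ∀ a ∈ R, ∀ b ∈ R, a ≠ b → Disjoint (S a) (S b)) (hS₀ : ∀ a ∈ R, Disjoint S₀ (S a))
    {E : Set Ω} (hE : MeasurableSet[𝒯.sigmaOn S₀] E) {F : ι → Set Ω}
    (hF : ∀ a ∈ R, MeasurableSet[𝒯.sigmaOn (S a)] (F a)) :
    μ.real (E ∩ ⋂ a ∈ R, F a) = μ.real E * ∏ a ∈ R, μ.real (F a) := by
  classical
  induction R using Finset.induction_on generalizing E S₀ with
  | empty => simp
  | insert a R ha ih =>
    rw [Finset.set_biInter_insert, ← Set.inter_assoc, Finset.prod_insert ha, ← mul_assoc,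
      ← 𝒯.measureReal_inter (hS₀ a (by simp)) hE (hF a (by simp))]
    refine ih (S₀ ∪ S a) (fun b hb c hc => hS b (by simp [hb]) c (by simp [hc])) ?_ ?_
      (fun b hb => hF b (by simp [hb]))
    · intro b hb
      rw [Set.disjoint_union_left]
      exact ⟨hS₀ b (by simp [hb]), hS a (by simp) b (by simp [hb]) (by rintro rfl; exact ha hb)⟩
    · exact @MeasurableSet.inter _ (𝒯.sigmaOn _) _ _ (𝒯.sigmaOn_mono Set.subset_union_left _ hE)
        (𝒯.sigmaOn_mono Set.subset_union_right _ (hF a (by simp)))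

end Independence

end BranchingTree

/-! ### Large deviations for the number of surviving children -/

namespace BranchingTree

variable {Ω : Type*} [MeasurableSpace Ω] {μ : Measure Ω} {V : Type*}

section Growth

variable (𝒯 : BranchingTree μ V)

open Classical in
/-- The number of elements of `Ch` that survive, given that their parent does. -/
noncomputable def kept (Ch : V → Finset V) (v : V) (ω : Ω) : ℕ :=
  ((Ch v).filter fun w => ω ∈ 𝒯.keep w).card

theorem kept_eq_sum (Ch : V → Finset V) (v : V) (ω : Ω) :
    (𝒯.kept Ch v ω : ℝ) = ∑ w ∈ Ch v, (𝒯.keep w).indicator (fun _ => (1 : ℝ)) ω := by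
  classical
  simp only [Set.indicator_apply, Finset.sum_boole, kept]

theorem measurable_kept {Ch : V → Finset V} {v : V} (h : Ch v ⊆ 𝒯.children v) :
    Measurable[𝒯.sigma v] fun ω => (𝒯.kept Ch v ω : ℝ) := by
  simp only [kept_eq_sum]
  refine @Finset.measurable_fun_sum _ _ _ _ _ _ (𝒯.sigma v) _ _ fun w hw => ?_
  exact (@measurable_const _ _ _ (𝒯.sigma v) _).indicator (𝒯.measurableSet_keep_of_mem (h hw))

theorem kept_le {Ch : V → Finset V} {v : V} (h : Ch v ⊆ 𝒯.children v) (ω : Ω) :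
    𝒯.kept Ch v ω ≤ 𝒯.bound := by
  classical
  exact (Finset.card_filter_le _ _).trans ((Finset.card_le_card h).trans (𝒯.card_children_le v))

theorem measurableSet_keep' {v w : V} (h : w ∈ 𝒯.children v) : MeasurableSet (𝒯.keep w) :=
  𝒯.sigma_le v _ (𝒯.measurableSet_keep_of_mem h)

theorem integral_kept [IsProbabilityMeasure μ] {Ch : V → Finset V} {v : V}
    (h : Ch v ⊆ 𝒯.children v) :
    ∫ ω, (𝒯.kept Ch v ω : ℝ) ∂μ = ∑ w ∈ Ch v, μ.real (𝒯.keep w) := by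
  simp only [kept_eq_sum]
  rw [integral_finsetSum]
  · refine Finset.sum_congr rfl fun w hw => ?_
    rw [integral_indicator (𝒯.measurableSet_keep' (h hw))]
    simp
  · intro w hw
    exact (integrable_const _).indicator (𝒯.measurableSet_keep' (h hw))

/-- The exponent in the large deviation estimate. -/
noncomputable def rate : ℝ := 1 / (2 * (𝒯.bound : ℝ) ^ 2)

theorem two_le_bound [IsProbabilityMeasure μ] {Ch : V → Finset V} {v : V}
    (h : Ch v ⊆ 𝒯.children v) (h2 : 2 ≤ ∑ w ∈ Ch v, μ.real (𝒯.keep w)) :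
    2 ≤ (Ch v).card ∧ 2 ≤ 𝒯.bound := by
  have h3 : (2 : ℝ) ≤ (Ch v).card := by
    refine h2.trans ((Finset.sum_le_sum fun w _ => measureReal_le_one).trans ?_)
    simp
  have h4 : 2 ≤ (Ch v).card := by exact_mod_cast h3
  exact ⟨h4, h4.trans ((Finset.card_le_card h).trans (𝒯.card_children_le v))⟩

/-- Hoeffding's inequality for independent counts in `[0, bound]`: their sum has mean at least `2 *
Q.card`, and the event is a deficit of `Q.card / 2`. -/
theorem measureReal_sum_kept_lt [IsProbabilityMeasure μ] (Q : Finset V) (Ch : V → Finset V)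
    (h : ∀ v ∈ Q, Ch v ⊆ 𝒯.children v)
    (h2 : ∀ v ∈ Q, 2 ≤ ∑ w ∈ Ch v, μ.real (𝒯.keep w)) :
    μ.real {ω | ∑ v ∈ Q, (𝒯.kept Ch v ω : ℝ) < 3 / 2 * Q.card} ≤
      Real.exp (-𝒯.rate * Q.card) := by
  classical
  rcases Q.eq_empty_or_nonempty with rfl | ⟨v₀, hv₀⟩
  · simp
  have hL : 2 ≤ 𝒯.bound := (𝒯.two_le_bound (h v₀ hv₀) (h2 v₀ hv₀)).2
  have hL' : (2 : ℝ) ≤ 𝒯.bound := by exact_mod_cast hL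
  have hQ : (0 : ℝ) < Q.card := by exact_mod_cast Finset.card_pos.2 ⟨v₀, hv₀⟩
  -- The sign turns the lower tail into an upper one; the zero outside `Q` gives an independent
  -- family indexed by all of `V`.
  set X : V → Ω → ℝ := fun v ω => if v ∈ Q then -(𝒯.kept Ch v ω : ℝ) else 0 with hX
  have hXm : ∀ v, Measurable[𝒯.sigma v] (X v) := by
    intro v
    by_cases hv : v ∈ Q
    · simp only [hX, hv, if_true]
      exact @Measurable.neg _ _ _ _ _ (𝒯.sigma v) _ (𝒯.measurable_kept (h v hv))
    · simp only [hX, hv, if_false]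
      exact @measurable_const _ _ _ (𝒯.sigma v) _
  have hXm' : ∀ v, Measurable (X v) := fun v => (hXm v).mono (𝒯.sigma_le v) le_rfl
  have hind : iIndepFun (fun v ω => X v ω - ∫ ω, X v ω ∂μ) μ := by
    have : iIndepFun X μ := by
      rw [iIndepFun_iff_iIndep]
      exact iIndep_of_iIndep_of_le 𝒯.indep fun v => (hXm v).comap_le
    exact this.comp (fun v x => x - ∫ ω, X v ω ∂μ) fun v => measurable_id.sub_const _
  have hsub : ∀ v ∈ Q, HasSubgaussianMGF (fun ω => X v ω - ∫ ω, X v ω ∂μ)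
      ((‖(0 : ℝ) - (-(𝒯.bound : ℝ))‖₊ / 2) ^ 2) μ := by
    intro v hv
    refine hasSubgaussianMGF_of_mem_Icc (hXm' v).aemeasurable (ae_of_all _ fun ω => ?_)
    simp only [hX, hv, if_true, Set.mem_Icc, neg_le_neg_iff, Left.neg_nonpos_iff]
    exact ⟨by exact_mod_cast 𝒯.kept_le (h v hv) ω, by positivity⟩
  have key := HasSubgaussianMGF.measure_sum_ge_le_of_iIndepFun hind hsub
    (ε := (Q.card : ℝ) / 2) (by positivity)
  refine (measureReal_mono ?_).trans (key.trans ?_)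
  · intro ω hω
    simp only [Set.mem_ofPred_eq] at hω ⊢
    have h3 : ∀ v ∈ Q, 2 - (𝒯.kept Ch v ω : ℝ) ≤ X v ω - ∫ ω, X v ω ∂μ := by
      intro v hv
      simp only [hX, hv, if_true]
      rw [integral_neg, 𝒯.integral_kept (h v hv)]
      linarith [h2 v hv]
    have h4 := Finset.sum_le_sum h3
    rw [Finset.sum_sub_distrib, Finset.sum_const, nsmul_eq_mul] at h4
    linarith
  · apply Real.exp_le_exp.2
    apply le_of_eq
    simp only [Finset.sum_const, nsmul_eq_mul, rate]
    have : ‖(0 : ℝ) - (-(𝒯.bound : ℝ))‖ = 𝒯.bound := by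
      rw [zero_sub, neg_neg, Real.norm_of_nonneg (by linarith)]
    push_cast
    rw [this]
    field_simp

/-- Given the history, it is unlikely that many surviving vertices have few surviving children. -/
theorem measureReal_few_kept_le [IsProbabilityMeasure μ] (A : V) (j : ℕ) (W : Finset V)
    (Ch : V → Finset V)
    (h : ∀ v ∈ W, Ch v ⊆ 𝒯.children v)
    (h2 : ∀ v ∈ W, 2 ≤ ∑ w ∈ Ch v, μ.real (𝒯.keep w)) {S : Set V}
    (hS : ∀ v ∈ S, 𝒯.lvl v < 𝒯.lvl A + j) {E : Set Ω} (hE : MeasurableSet[𝒯.sigmaOn S] E)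
    (a : ℝ) [DecidableEq V] :
    μ.real {ω ∈ E | a ≤ (𝒯.alive A ω j ∩ W).card ∧
      ∑ v ∈ 𝒯.alive A ω j ∩ W, (𝒯.kept Ch v ω : ℝ) < 3 / 2 * a} ≤
      μ.real E * Real.exp (-𝒯.rate * a) := by
  -- Once the surviving set `R` of generation `j` is frozen, the sum runs over deterministic
  -- vertices whose offspring are independent of the past.
  set few : Finset V → Set Ω := fun Q =>
    {ω | ∑ v ∈ Q, (𝒯.kept Ch v ω : ℝ) < 3 / 2 * Q.card} with hfew
  set 𝓡 := (𝒯.desc A j).powerset.filter fun R => a ≤ (R ∩ W).card with h𝓡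
  set T : Set V := {v | v ∈ 𝒯.desc A j}
  have hdisj : Disjoint (S ∪ 𝒯.belowLT A j) T := by
    rw [Set.disjoint_left]
    rintro v (hv | hv) hvT
    · have := hS v hv
      rw [𝒯.lvl_of_mem_desc hvT] at this
      omega
    · have := 𝒯.lvl_lt_of_mem_belowLT hv
      rw [𝒯.lvl_of_mem_desc hvT] at this
      omega
  have hmE : ∀ R, MeasurableSet[𝒯.sigmaOn (S ∪ 𝒯.belowLT A j)]
      (E ∩ {ω | 𝒯.alive A ω j = R}) := fun R =>
    @MeasurableSet.inter _ (𝒯.sigmaOn _) _ _ (𝒯.sigmaOn_mono Set.subset_union_left _ hE)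
      (𝒯.sigmaOn_mono Set.subset_union_right _ (𝒯.measurableSet_alive_eq A j R))
  have hsub : {ω ∈ E | a ≤ (𝒯.alive A ω j ∩ W).card ∧
      ∑ v ∈ 𝒯.alive A ω j ∩ W, (𝒯.kept Ch v ω : ℝ) < 3 / 2 * a} ⊆
      ⋃ R ∈ 𝓡, (E ∩ {ω | 𝒯.alive A ω j = R}) ∩ few (R ∩ W) := by
    rintro ω ⟨hωE, h3, h4⟩
    simp only [Set.mem_iUnion]
    refine ⟨𝒯.alive A ω j, ?_, ⟨hωE, rfl⟩, ?_⟩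
    · simp [h𝓡, 𝒯.alive_subset_desc, h3]
    · simp only [hfew, Set.mem_ofPred_eq]
      linarith
  have hmfew : ∀ R ∈ 𝓡, MeasurableSet[𝒯.sigmaOn T] (few (R ∩ W)) := by
    intro R hR
    simp only [h𝓡, Finset.mem_filter, Finset.mem_powerset] at hR
    refine @measurableSet_lt _ _ _ _ _ (𝒯.sigmaOn T) _ _ _ _ _ ?_ (@measurable_const _ _ _ (𝒯.sigmaOn T) _)
    refine @Finset.measurable_fun_sum _ _ _ _ _ _ (𝒯.sigmaOn T) _ _ fun v hv => ?_
    rw [Finset.mem_inter] at hv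
    exact (𝒯.measurable_kept (h v hv.2)).mono (𝒯.sigma_le_sigmaOn (hR.1 hv.1)) le_rfl
  calc _ ≤ μ.real (⋃ R ∈ 𝓡, (E ∩ {ω | 𝒯.alive A ω j = R}) ∩ few (R ∩ W)) :=
        measureReal_mono hsub (measure_ne_top _ _)
    _ ≤ ∑ R ∈ 𝓡, μ.real ((E ∩ {ω | 𝒯.alive A ω j = R}) ∩ few (R ∩ W)) :=
        measureReal_biUnion_finset_le _ _
    _ ≤ ∑ R ∈ 𝓡, μ.real (E ∩ {ω | 𝒯.alive A ω j = R}) * Real.exp (-𝒯.rate * a) := by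
        refine Finset.sum_le_sum fun R hR => ?_
        rw [𝒯.measureReal_inter hdisj (hmE R) (hmfew R hR)]
        refine mul_le_mul_of_nonneg_left ?_ measureReal_nonneg
        refine (𝒯.measureReal_sum_kept_lt (R ∩ W) Ch (fun v hv => h v (Finset.mem_inter.1 hv).2)
          (fun v hv => h2 v (Finset.mem_inter.1 hv).2)).trans ?_
        apply Real.exp_le_exp.2
        have h5 : a ≤ (R ∩ W).card := (Finset.mem_filter.1 hR).2
        have h6 : 0 ≤ 𝒯.rate := by unfold rate; positivity
        nlinarith
    _ = μ.real (⋃ R ∈ 𝓡, E ∩ {ω | 𝒯.alive A ω j = R}) * Real.exp (-𝒯.rate * a) := by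
        rw [← Finset.sum_mul, measureReal_biUnion_finset]
        · intro R _ R' _ hne
          rw [Function.onFun, Set.disjoint_left]
          rintro ω ⟨-, h1⟩ ⟨-, h2⟩
          exact hne (h1.symm.trans h2)
        · exact fun R _ => 𝒯.sigmaOn_le _ _ (hmE R)
    _ ≤ μ.real E * Real.exp (-𝒯.rate * a) := by
        refine mul_le_mul_of_nonneg_right (measureReal_mono ?_) (Real.exp_pos _).le
        exact Set.iUnion₂_subset fun R _ => Set.inter_subset_left

end Growth

end BranchingTree

/-- Since `exp x ≥ x ^ n / n!`, the exponential factor is at most a constant times `(a ^ n) ^ (-j)`,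
and a large `n` makes this beat `Γ ^ j`. -/
theorem summable_pow_mul_exp_neg_pow (G Γ κ a : ℝ) (hκ : 0 < κ) (ha : 1 < a) :
    Summable fun j : ℕ => G * Γ ^ j * Real.exp (-κ * a ^ j) := by
  obtain ⟨n, hn⟩ := pow_unbounded_of_one_lt (2 * (|Γ| + 1)) ha
  have ha0 : 0 < a := by linarith
  refine Summable.of_norm_bounded (g := fun j => |G| * (n.factorial / κ ^ n) * (1 / 2 : ℝ) ^ j)
    (summable_geometric_two.mul_left _) fun j => ?_
  have h1 := Real.pow_div_factorial_le_exp (κ * a ^ j) (by positivity) n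
  have hf : (0 : ℝ) < n.factorial := by exact_mod_cast n.factorial_pos
  have h2 : Real.exp (-κ * a ^ j) ≤ n.factorial / κ ^ n * (1 / (a ^ n) ^ j) := by
    rw [neg_mul, Real.exp_neg, inv_le_comm₀ (Real.exp_pos _) (by positivity)]
    refine le_trans (le_of_eq ?_) h1
    rw [mul_pow, ← pow_mul, ← pow_mul, mul_comm j n]
    field_simp
  have h3 : |Γ| ^ j * (1 / (a ^ n) ^ j) ≤ (1 / 2 : ℝ) ^ j := by
    rw [← one_div_pow, ← mul_pow]
    refine pow_le_pow_left₀ (by positivity) ?_ _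
    rw [mul_one_div, div_le_div_iff₀ (by positivity) (by norm_num)]
    linarith [abs_nonneg Γ]
  rw [norm_mul, norm_mul, norm_pow, Real.norm_eq_abs, Real.norm_eq_abs, Real.norm_eq_abs,
    Real.abs_exp]
  calc |G| * |Γ| ^ j * Real.exp (-κ * a ^ j)
      ≤ |G| * |Γ| ^ j * (n.factorial / κ ^ n * (1 / (a ^ n) ^ j)) := by gcongr
    _ = |G| * (n.factorial / κ ^ n) * (|Γ| ^ j * (1 / (a ^ n) ^ j)) := by ring
    _ ≤ _ := by gcongr

/-! ### Exponential growth with uniformly positive probability -/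

namespace BranchingTree

variable {Ω : Type*} [MeasurableSpace Ω] {μ : Measure Ω} {V X : Type*} (𝒯 : BranchingTree μ V)

open Classical in
/-- The surviving descendants that are relevant to `x`. -/
noncomputable def hits (U : V → Set X) (A : V) (ω : Ω) (j : ℕ) (x : X) : Finset V :=
  𝒯.alive A ω j ∩ (𝒯.desc A j).filter fun v => x ∈ U v

theorem mem_hits {U : V → Set X} {A : V} {ω : Ω} {j : ℕ} {x : X} {v : V} :
    v ∈ 𝒯.hits U A ω j x ↔ v ∈ 𝒯.alive A ω j ∧ x ∈ U v := by
  simp only [hits, Finset.mem_inter, Finset.mem_filter]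
  exact ⟨fun h => ⟨h.1, h.2.2⟩, fun h => ⟨h.1, 𝒯.alive_subset_desc _ _ _ h.1, h.2⟩⟩

/-- The event that the number of hits of the points that are followed grows exponentially. -/
def growth (U : V → Set X) (A : V) (P : ℕ → Set X) : Set Ω :=
  {ω | ∀ j, ∀ x ∈ P j, (3 / 2 : ℝ) ^ j ≤ (𝒯.hits U A ω j x).card}

theorem measurableSet_growth (U : V → Set X) (A : V) (P : ℕ → Set X) :
    MeasurableSet[𝒯.sigmaOn (𝒯.below A)] (𝒯.growth U A P) := by
  classical
  have : 𝒯.growth U A P = ⋂ j, {ω | ∀ x ∈ P j, (3 / 2 : ℝ) ^ j ≤ (𝒯.hits U A ω j x).card} := by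
    ext ω
    simp [growth]
  rw [this]
  refine @MeasurableSet.iInter _ _ (𝒯.sigmaOn _) _ _ fun j => ?_
  exact 𝒯.sigmaOn_mono (𝒯.belowLT_subset_below A j) _ (𝒯.measurableSet_alive A j fun R =>
    ∀ x ∈ P j, (3 / 2 : ℝ) ^ j ≤ (R ∩ (𝒯.desc A j).filter fun v => x ∈ U v).card)

/-- The points of `P (j + 1)` inherit the hits of finitely many points of `P j`. -/
def Inherits (U : V → Set X) (Ch : X → V → Finset V) (A : V) (P : ℕ → Set X) (G Γ : ℝ) : Prop :=
  P 0 ⊆ U A ∧ ∀ j, ∃ F : Finset X, ↑F ⊆ P j ∧ (F.card : ℝ) ≤ G * Γ ^ j ∧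
    ∀ x' ∈ P (j + 1), ∃ x ∈ F, ∀ v ∈ 𝒯.desc A j, x ∈ U v → ∀ w ∈ Ch x v, x' ∈ U w

-- Distinct parents have disjoint sets of children, so the survivors on the left are distinct hits
-- of `x'`.
variable {𝒯} in
theorem sum_kept_le_card_hits {U : V → Set X} {Ch : X → V → Finset V} {A : V} {j : ℕ}
    {x x' : X} (hCh : ∀ v, x ∈ U v → Ch x v ⊆ 𝒯.children v)
    (h : ∀ v ∈ 𝒯.desc A j, x ∈ U v → ∀ w ∈ Ch x v, x' ∈ U w) (ω : Ω) :
    ∑ v ∈ 𝒯.hits U A ω j x, 𝒯.kept (Ch x) v ω ≤ (𝒯.hits U A ω (j + 1) x').card := by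
  classical
  have hd : ((𝒯.hits U A ω j x : Finset V) : Set V).PairwiseDisjoint fun v =>
      (Ch x v).filter fun w => ω ∈ 𝒯.keep w := by
    intro v hv v' hv' hne
    rw [Function.onFun, Finset.disjoint_left]
    intro w hw hw'
    rw [Finset.mem_filter] at hw hw'
    apply hne
    rw [← (𝒯.mem_children.1 (hCh v (𝒯.mem_hits.1 hv).2 hw.1)).2,
      ← (𝒯.mem_children.1 (hCh v' (𝒯.mem_hits.1 hv').2 hw'.1)).2]
  have := Finset.card_biUnion hd
  have h' : ∀ v ω, 𝒯.kept (Ch x) v ω = ((Ch x v).filter fun w => ω ∈ 𝒯.keep w).card := by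
    intro v ω; unfold kept; congr
  simp only [h']
  rw [← this]
  refine Finset.card_le_card fun w hw => ?_
  obtain ⟨v, hv, hw⟩ := Finset.mem_biUnion.1 hw
  obtain ⟨hv, hxv⟩ := 𝒯.mem_hits.1 hv
  obtain ⟨hw, hk⟩ := Finset.mem_filter.1 hw
  exact 𝒯.mem_hits.2 ⟨𝒯.mem_alive_succ.2 ⟨v, hv, hCh v hxv hw, hk⟩,
    h v (𝒯.alive_subset_desc _ _ _ hv) hxv w hw⟩

/-- The event that all the descendants up to generation `n` survive. -/
def full (A : V) (n : ℕ) : Set Ω :=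
  ⋂ j ∈ Finset.range n, ⋂ v ∈ 𝒯.desc A j, ⋂ w ∈ 𝒯.children v, 𝒯.keep w

theorem measurableSet_children (v : V) :
    MeasurableSet[𝒯.sigma v] (⋂ w ∈ 𝒯.children v, 𝒯.keep w) :=
  @Finset.measurableSet_biInter _ _ (𝒯.sigma v) _ _ fun _ hw => 𝒯.measurableSet_keep_of_mem hw

theorem measurableSet_full (A : V) (n : ℕ) :
    MeasurableSet[𝒯.sigmaOn (𝒯.belowLT A n)] (𝒯.full A n) := by
  refine @Finset.measurableSet_biInter _ _ (𝒯.sigmaOn _) _ _ fun j hj => ?_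
  refine @Finset.measurableSet_biInter _ _ (𝒯.sigmaOn _) _ _ fun v hv => ?_
  exact 𝒯.sigma_le_sigmaOn (S := 𝒯.belowLT A n) ⟨j, Finset.mem_range.1 hj, hv⟩ _
    (𝒯.measurableSet_children v)

/-- Full survival is an intersection of independent events at no more than `∑ bound ^ j` vertices,
each of probability at least `lower`. It starts the growth while Hoeffding's bound is still too
weak. -/
theorem exists_le_measureReal_full [IsProbabilityMeasure μ] (n : ℕ) :
    ∃ h > 0, ∀ A, h ≤ μ.real (𝒯.full A n) := by
  classical
  have hl : 𝒯.lower ≤ 1 ∨ IsEmpty V := by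
    rcases isEmpty_or_nonempty V with h | ⟨⟨v⟩⟩
    · exact Or.inr h
    · exact Or.inl ((𝒯.lower_le v).trans measureReal_le_one)
  refine ⟨𝒯.lower ^ (∑ j ∈ Finset.range n, 𝒯.bound ^ j), pow_pos 𝒯.lower_pos _, fun A => ?_⟩
  replace hl : 𝒯.lower ≤ 1 := hl.resolve_right fun h => h.elim A
  set R : Finset V := (Finset.range n).biUnion (𝒯.desc A) with hR
  have h1 : 𝒯.full A n = Set.univ ∩ ⋂ v ∈ R, ⋂ w ∈ 𝒯.children v, 𝒯.keep w := by
    ext ω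
    simp only [full, hR, Set.mem_iInter, Finset.mem_biUnion, Set.mem_inter_iff, Set.mem_univ,
      true_and]
    exact ⟨fun h v ⟨j, hj, hv⟩ => h j hj v hv, fun h j hj v hv => h v ⟨j, hj, hv⟩⟩
  rw [h1, 𝒯.measureReal_inter_biInter R (fun v => {v}) ∅ (by simp) (by simp)
    (@MeasurableSet.univ _ (𝒯.sigmaOn _))
    (fun v _ => 𝒯.sigma_le_sigmaOn (S := {v}) rfl _ (𝒯.measurableSet_children v))]
  rw [probReal_univ, one_mul]
  calc 𝒯.lower ^ (∑ j ∈ Finset.range n, 𝒯.bound ^ j) ≤ 𝒯.lower ^ R.card := by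
        refine pow_le_pow_of_le_one 𝒯.lower_pos.le hl ?_
        exact Finset.card_biUnion_le.trans (Finset.sum_le_sum fun j _ => 𝒯.card_desc_le A j)
    _ = ∏ v ∈ R, 𝒯.lower := by simp
    _ ≤ _ := Finset.prod_le_prod (fun _ _ => 𝒯.lower_pos.le) fun v _ => 𝒯.lower_le_children v

/-- Exponential growth has positive probability, uniformly in the starting vertex. -/
theorem exists_le_measureReal_growth [IsProbabilityMeasure μ] (G Γ : ℝ) (U : V → Set X)
    (Ch : X → V → Finset V)
    (hCh : ∀ x v, x ∈ U v → Ch x v ⊆ 𝒯.children v ∧ 2 ≤ ∑ w ∈ Ch x v, μ.real (𝒯.keep w)) :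
    ∃ q > 0, ∀ A P, 𝒯.Inherits U Ch A P G Γ → q ≤ μ.real (𝒯.growth U A P) := by
  classical
  -- If no vertex is relevant to any point, `bound` may vanish, and then `rate = 1 / 0 = 0`. But in
  -- this case no points are followed and growth is certain.
  by_cases hU : ∃ x v, x ∈ U v
  swap
  · refine ⟨1 / 2, by norm_num, fun A P hP => ?_⟩
    have hP0 : ∀ j, ∀ x, x ∉ P j := by
      intro j
      induction j with
      | zero => exact fun x hx => hU ⟨x, A, hP.1 hx⟩
      | succ j ih =>
        intro x hx
        obtain ⟨F, hF, -, h⟩ := hP.2 j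
        obtain ⟨y, hy, -⟩ := h x hx
        exact ih y (hF hy)
    have : 𝒯.growth U A P = Set.univ := by
      ext ω
      simp [growth, hP0]
    rw [this, probReal_univ]
    norm_num
  obtain ⟨x₀, v₀, h₀⟩ := hU
  have hb := (𝒯.two_le_bound (hCh x₀ v₀ h₀).1 (hCh x₀ v₀ h₀).2).2
  have hκ : 0 < 𝒯.rate := by
    have : (0 : ℝ) < 𝒯.bound := by exact_mod_cast (by omega : 0 < 𝒯.bound)
    unfold rate
    positivity
  set b : ℕ → ℝ := fun j => G * Γ ^ j * Real.exp (-𝒯.rate * (3 / 2 : ℝ) ^ j) with hbdef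
  have hsum : Summable b := summable_pow_mul_exp_neg_pow G Γ _ _ hκ (by norm_num)
  -- From generation `n` on the failure bounds sum to less than one half; before it, everything is
  -- made to survive.
  obtain ⟨n, hn⟩ : ∃ n, ∑' i, b (i + n) < 1 / 2 :=
    ((tendsto_sum_nat_add b).eventually (gt_mem_nhds (by norm_num))).exists
  obtain ⟨h, hh, hfull⟩ := 𝒯.exists_le_measureReal_full n
  refine ⟨h / 2, by linarith, fun A P hP => ?_⟩
  obtain ⟨hP0, hP⟩ := hP
  choose F hFP hFc hF using hP
  set E := 𝒯.full A n with hE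
  set bad : ℕ → X → Set Ω := fun j x =>
    {ω ∈ E | (3 / 2 : ℝ) ^ j ≤ (𝒯.hits U A ω j x).card ∧
      ∑ v ∈ 𝒯.hits U A ω j x, (𝒯.kept (Ch x) v ω : ℝ) < 3 / 2 * (3 / 2 : ℝ) ^ j} with hbad
  have hbadle : ∀ j, n ≤ j → ∀ x ∈ P j,
      μ.real (bad j x) ≤ μ.real E * Real.exp (-𝒯.rate * (3 / 2 : ℝ) ^ j) := by
    intro j hj x hx
    exact 𝒯.measureReal_few_kept_le A j _ (Ch x)
      (fun v hv => (hCh x v (Finset.mem_filter.1 hv).2).1)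
      (fun v hv => (hCh x v (Finset.mem_filter.1 hv).2).2)
      (S := 𝒯.belowLT A n)
      (fun v hv => (𝒯.lvl_lt_of_mem_belowLT hv).trans_le (by omega))
      (𝒯.measurableSet_full A n) _
  have hFnonneg : ∀ j, 0 ≤ G * Γ ^ j := fun j => (Nat.cast_nonneg _).trans (hFc j)
  have hb0 : ∀ j, 0 ≤ b j := fun j => mul_nonneg (hFnonneg j) (Real.exp_pos _).le
  -- Growth propagates: for `j < n` because each hit has at least two successors and all survive,
  -- afterwards because no watched point fails.
  have hcover : E ⊆ 𝒯.growth U A P ∪ ⋃ i, ⋃ x ∈ F (i + n), bad (i + n) x := by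
    intro ω hω
    by_contra hcon
    simp only [Set.mem_union, Set.mem_iUnion, not_or, not_exists] at hcon
    obtain ⟨hg, hnb⟩ := hcon
    apply hg
    intro j
    induction j with
    | zero =>
      intro x hx
      have : A ∈ 𝒯.hits U A ω 0 x := 𝒯.mem_hits.2 ⟨by simp [alive], hP0 hx⟩
      simpa using Finset.card_pos.2 ⟨A, this⟩
    | succ j ih =>
      intro x' hx'
      obtain ⟨x, hxF, hx⟩ := hF j x' hx'
      have h1 := ih x (hFP j hxF)
      have h2 : ((∑ v ∈ 𝒯.hits U A ω j x, 𝒯.kept (Ch x) v ω : ℕ) : ℝ) ≤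
          (𝒯.hits U A ω (j + 1) x').card :=
        Nat.cast_le.2 (sum_kept_le_card_hits (fun v hv => (hCh x v hv).1) hx ω)
      refine le_trans ?_ h2
      rw [pow_succ', Nat.cast_sum]
      rcases lt_or_ge j n with hj | hj
      · have h3 : ∀ v ∈ 𝒯.hits U A ω j x, (2 : ℝ) ≤ 𝒯.kept (Ch x) v ω := by
          intro v hv
          obtain ⟨hv, hxv⟩ := 𝒯.mem_hits.1 hv
          have h4 : 𝒯.kept (Ch x) v ω = (Ch x v).card := by
            unfold kept
            congr 1
            refine Finset.filter_true_of_mem fun w hw => ?_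
            rw [hE, full] at hω
            simp only [Set.mem_iInter] at hω
            exact hω j (Finset.mem_range.2 hj) v (𝒯.alive_subset_desc _ _ _ hv) w
              ((hCh x v hxv).1 hw)
          rw [h4]
          exact_mod_cast (𝒯.two_le_bound (hCh x v hxv).1 (hCh x v hxv).2).1
        have h5 := Finset.card_nsmul_le_sum _ _ _ h3
        rw [nsmul_eq_mul] at h5
        have : (0 : ℝ) < (3 / 2 : ℝ) ^ j := by positivity
        linarith
      · by_contra hlt
        have := hnb (j - n) x
        rw [Nat.sub_add_cancel hj] at this
        exact this hxF ⟨hω, h1, not_le.1 hlt⟩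
  have hμbad : μ.real (⋃ i, ⋃ x ∈ F (i + n), bad (i + n) x) ≤ μ.real E / 2 := by
    have h1 : ∀ i, μ (⋃ x ∈ F (i + n), bad (i + n) x) ≤
        ENNReal.ofReal (μ.real E * b (i + n)) := by
      intro i
      rw [← ofReal_measureReal (measure_ne_top _ _)]
      apply ENNReal.ofReal_le_ofReal
      refine (measureReal_biUnion_finset_le _ _).trans ?_
      refine (Finset.sum_le_sum fun x hx => hbadle (i + n) (by omega) x (hFP _ hx)).trans ?_
      rw [Finset.sum_const, nsmul_eq_mul]
      have := hFc (i + n)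
      calc ((F (i + n)).card : ℝ) * (μ.real E * Real.exp (-𝒯.rate * (3 / 2 : ℝ) ^ (i + n)))
          ≤ (G * Γ ^ (i + n)) * (μ.real E * Real.exp (-𝒯.rate * (3 / 2 : ℝ) ^ (i + n))) := by
            gcongr
        _ = _ := by rw [hbdef]; ring
    have h2 : Summable fun i => μ.real E * b (i + n) :=
      ((summable_nat_add_iff n).2 hsum).mul_left _
    have h3 : μ (⋃ i, ⋃ x ∈ F (i + n), bad (i + n) x) ≤
        ENNReal.ofReal (∑' i, μ.real E * b (i + n)) := by
      rw [ENNReal.ofReal_tsum_of_nonneg (fun i => mul_nonneg measureReal_nonneg (hb0 _)) h2]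
      exact (measure_iUnion_le _).trans (ENNReal.tsum_le_tsum h1)
    have h4 := ENNReal.toReal_mono ENNReal.ofReal_ne_top h3
    rw [ENNReal.toReal_ofReal (tsum_nonneg fun i => mul_nonneg measureReal_nonneg (hb0 _)),
      tsum_mul_left] at h4
    refine h4.trans ?_
    have : 0 ≤ μ.real E := measureReal_nonneg
    nlinarith
  have h1 : μ.real E ≤ μ.real (𝒯.growth U A P) +
      μ.real (⋃ i, ⋃ x ∈ F (i + n), bad (i + n) x) :=
    (measureReal_mono hcover).trans (measureReal_union_le _ _)
  have h2 := hfull A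
  linarith

end BranchingTree

/-! ### The zero-one law and simultaneous tasks -/

namespace BranchingTree

variable {Ω : Type*} [mΩ : MeasurableSpace Ω] {μ : Measure Ω} {V X : Type*} (𝒯 : BranchingTree μ V)

/-- The history of the tree. -/
def filtration : Filtration ℕ mΩ where
  seq n := 𝒯.sigmaOn {v | 𝒯.lvl v < n}
  mono' _ _ h := 𝒯.sigmaOn_mono fun _ hv => lt_of_lt_of_le hv h
  le' _ := 𝒯.sigmaOn_le _

theorem sigmaOn_le_iSup_filtration (S : Set V) : 𝒯.sigmaOn S ≤ ⨆ n, 𝒯.filtration n :=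
  iSup₂_le fun v _ => le_trans (𝒯.sigma_le_sigmaOn (S := {u | 𝒯.lvl u < 𝒯.lvl v + 1})
    (Nat.lt_succ_self _)) (le_iSup (fun n => 𝒯.filtration n) (𝒯.lvl v + 1))

/-- If events that concern the subtrees have probabilities bounded from below then almost surely,
when the tree is infinite, such an event happens at a surviving vertex. -/
theorem ae_exists_of_le_measureReal [IsProbabilityMeasure μ] (root : V) (hroot : 𝒯.lvl root = 0)
    (Gd : V → Set Ω) (hm : ∀ A, MeasurableSet[𝒯.sigmaOn (𝒯.below A)] (Gd A)) (q : ℝ) (hq : 0 < q)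
    (h : ∀ A, q ≤ μ.real (Gd A)) :
    ∀ᵐ ω ∂μ, (∀ n, (𝒯.alive root ω n).Nonempty) →
      ∃ n, ∃ A ∈ 𝒯.alive root ω n, ω ∈ Gd A := by
  classical
  set Γ : Set Ω := ⋃ n, ⋃ A ∈ 𝒯.desc root n, {ω | A ∈ 𝒯.alive root ω n} ∩ Gd A with hΓ
  set f : Ω → ℝ := Γ.indicator fun _ => 1 with hf
  have hΓm : MeasurableSet[⨆ n, 𝒯.filtration n] Γ := by
    refine @MeasurableSet.iUnion _ _ (⨆ n, 𝒯.filtration n) _ _ fun n => ?_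
    refine @Finset.measurableSet_biUnion _ _ (⨆ n, 𝒯.filtration n) _ _ fun A _ => ?_
    exact @MeasurableSet.inter _ (⨆ n, 𝒯.filtration n) _ _
      (𝒯.sigmaOn_le_iSup_filtration _ _ (𝒯.measurableSet_mem_alive root A n))
      (𝒯.sigmaOn_le_iSup_filtration _ _ (hm A))
  have hle : (⨆ n, 𝒯.filtration n) ≤ mΩ := iSup_le fun n => 𝒯.filtration.le n
  have hfi : Integrable f μ := (integrable_const _).indicator (hle _ hΓm)
  have hlim := tendsto_ae_condExp (ℱ := 𝒯.filtration) (μ := μ) f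
  have hself : μ[f | ⨆ n, 𝒯.filtration n] = f :=
    condExp_of_stronglyMeasurable hle
      ((@stronglyMeasurable_const _ _ (⨆ n, 𝒯.filtration n) _ _).indicator hΓm) hfi
  -- The subtree below `A` is independent of the history before level `n`. So where `A` is alive,
  -- the conditional probability of `Γ` is at least that of `Gd A`.
  have hcond : ∀ n, ∀ A ∈ 𝒯.desc root n, ∀ᵐ ω ∂μ, A ∈ 𝒯.alive root ω n →
      q ≤ (μ[f | 𝒯.filtration n]) ω := by
    intro n A hA
    set g : Ω → ℝ := (Gd A).indicator fun _ => 1 with hg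
    have hGm : MeasurableSet (Gd A) := 𝒯.sigmaOn_le _ _ (hm A)
    have hgi : Integrable g μ := (integrable_const _).indicator hGm
    have hal : MeasurableSet[𝒯.filtration n] {ω | A ∈ 𝒯.alive root ω n} :=
      𝒯.sigmaOn_mono (T := {v | 𝒯.lvl v < n}) (fun v hv => by
        have := 𝒯.lvl_lt_of_mem_belowLT hv
        simpa [hroot] using this) _ (𝒯.measurableSet_mem_alive root A n)
    have hind : Indep (𝒯.sigmaOn (𝒯.below A)) (𝒯.filtration n) μ := by
      refine indep_iSup_of_disjoint 𝒯.sigma_le 𝒯.indep ?_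
      rw [Set.disjoint_left]
      intro v hv hv'
      have h1 := 𝒯.lvl_le_of_mem_below hv
      have h2 := 𝒯.lvl_of_mem_desc hA
      have h3 : 𝒯.lvl v < n := hv'
      omega
    have h1 : μ[g | 𝒯.filtration n] =ᵐ[μ] fun _ => ∫ ω, g ω ∂μ :=
      condExp_indep_eq (𝒯.sigmaOn_le _) (𝒯.filtration.le n)
        ((@stronglyMeasurable_const _ _ (𝒯.sigmaOn (𝒯.below A)) _ _).indicator (hm A)) hind
    have h2 := condExp_indicator (μ := μ) hgi hal
    have h3 : μ[{ω | A ∈ 𝒯.alive root ω n}.indicator g | 𝒯.filtration n] ≤ᵐ[μ]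
        μ[f | 𝒯.filtration n] := by
      refine condExp_mono (hgi.indicator (𝒯.filtration.le n _ hal)) hfi (ae_of_all _ fun ω => ?_)
      by_cases hω : ω ∈ {ω | A ∈ 𝒯.alive root ω n} ∩ Gd A
      · have : ω ∈ Γ := by
          simp only [hΓ, Set.mem_iUnion]
          exact ⟨n, A, hA, hω⟩
        simp [hf, hg, this, hω.1, hω.2]
      · have h0 : 0 ≤ f ω := Set.indicator_nonneg (fun _ _ => zero_le_one) _
        refine le_trans (le_of_eq ?_) h0
        rw [hg, Set.indicator_indicator, Set.indicator_of_notMem hω]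
    filter_upwards [h1, h2, h3] with ω h1 h2 h3 hω
    rw [h2, Set.indicator_of_mem (by exact hω), h1, hg, integral_indicator hGm] at h3
    simp only [integral_const, measureReal_restrict_apply_univ, smul_eq_mul, mul_one] at h3
    exact (h A).trans h3
  have hcond' : ∀ᵐ ω ∂μ, ∀ n, ∀ A ∈ 𝒯.desc root n, A ∈ 𝒯.alive root ω n →
      q ≤ (μ[f | 𝒯.filtration n]) ω := by
    rw [ae_all_iff]
    intro n
    exact (Finset.eventually_all (𝒯.desc root n)).2 (hcond n)
  filter_upwards [hlim, hcond'] with ω h1 h2 h3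
  rw [hself] at h1
  -- By Lévy's theorem the conditional probabilities tend to the indicator of `Γ`; on survival the
  -- limit is at least `q > 0`, hence `1`.
  have h4 : q ≤ f ω := by
    refine ge_of_tendsto' h1 fun n => ?_
    obtain ⟨A, hA⟩ := h3 n
    exact h2 n A (𝒯.alive_subset_desc _ _ _ hA) hA
  have h5 : ω ∈ Γ := by
    by_contra hω
    rw [hf, Set.indicator_of_notMem hω] at h4
    linarith
  simp only [hΓ, Set.mem_iUnion] at h5
  obtain ⟨n, A, -, h6, h7⟩ := h5
  exact ⟨n, A, h6, h7⟩

/-- The event that each task is successful at some surviving vertex `j` generations below. -/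
def allTasks {T : Type*} (U : V → Set X) (P : T → V → ℕ → Set X) (reps : ℕ → Finset T) (A : V)
    (j : ℕ) : Set Ω :=
  {ω | ∀ t ∈ reps (𝒯.lvl A + j), ∃ B ∈ 𝒯.alive A ω j, ω ∈ 𝒯.growth U B (P t B)}

theorem measurableSet_allTasks {T : Type*} (U : V → Set X) (P : T → V → ℕ → Set X)
    (reps : ℕ → Finset T) (A : V) (j : ℕ) :
    MeasurableSet[𝒯.sigmaOn (𝒯.below A)] (𝒯.allTasks U P reps A j) := by
  have : 𝒯.allTasks U P reps A j = ⋂ t ∈ reps (𝒯.lvl A + j), ⋃ B ∈ 𝒯.desc A j,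
      {ω | B ∈ 𝒯.alive A ω j} ∩ 𝒯.growth U B (P t B) := by
    ext ω
    simp only [allTasks, Set.mem_ofPred_eq, Set.mem_iInter, Set.mem_iUnion, Set.mem_inter_iff]
    refine forall₂_congr fun t _ => ⟨?_, ?_⟩
    · rintro ⟨B, h1, h2⟩
      exact ⟨B, 𝒯.alive_subset_desc _ _ _ h1, h1, h2⟩
    · rintro ⟨B, -, h1, h2⟩
      exact ⟨B, h1, h2⟩
  rw [this]
  refine @Finset.measurableSet_biInter _ _ (𝒯.sigmaOn _) _ _ fun t _ => ?_
  refine @Finset.measurableSet_biUnion _ _ (𝒯.sigmaOn _) _ _ fun B hB => ?_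
  exact @MeasurableSet.inter _ (𝒯.sigmaOn _) _ _
    (𝒯.sigmaOn_mono (𝒯.belowLT_subset_below A j) _ (𝒯.measurableSet_mem_alive A B j))
    (𝒯.sigmaOn_mono (𝒯.below_subset_of_mem_desc hB) _ (𝒯.measurableSet_growth U B _))

/-- Many surviving vertices make it unlikely that a task fails at all of them. -/
theorem measureReal_forall_notMem_growth_le [IsProbabilityMeasure μ] (U : V → Set X)
    (P : V → ℕ → Set X) (A : V) (j : ℕ) (q a : ℝ)
    (hq : 0 ≤ q) (h : ∀ B, q ≤ μ.real (𝒯.growth U B (P B))) :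
    μ.real {ω | a ≤ (𝒯.alive A ω j).card ∧ ∀ B ∈ 𝒯.alive A ω j, ω ∉ 𝒯.growth U B (P B)} ≤
      Real.exp (-q * a) := by
  classical
  -- Given the surviving set `R`, the subtrees below its members are independent, so all fail with
  -- probability at most `exp (-q) ^ R.card`.
  set 𝓡 := (𝒯.desc A j).powerset.filter fun R => a ≤ (R.card : ℝ) with h𝓡
  have hsub : {ω | a ≤ (𝒯.alive A ω j).card ∧
      ∀ B ∈ 𝒯.alive A ω j, ω ∉ 𝒯.growth U B (P B)} ⊆
      ⋃ R ∈ 𝓡, {ω | 𝒯.alive A ω j = R} ∩ ⋂ B ∈ R, (𝒯.growth U B (P B))ᶜ := by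
    rintro ω ⟨h1, h2⟩
    simp only [Set.mem_iUnion]
    refine ⟨𝒯.alive A ω j, ?_, rfl, ?_⟩
    · simp [h𝓡, 𝒯.alive_subset_desc, h1]
    · simpa using h2
  have hmeas : ∀ R, MeasurableSet {ω | 𝒯.alive A ω j = R} := fun R =>
    𝒯.sigmaOn_le _ _ (𝒯.measurableSet_alive_eq A j R)
  calc _ ≤ μ.real (⋃ R ∈ 𝓡, {ω | 𝒯.alive A ω j = R} ∩ ⋂ B ∈ R, (𝒯.growth U B (P B))ᶜ) :=
        measureReal_mono hsub (measure_ne_top _ _)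
    _ ≤ ∑ R ∈ 𝓡, μ.real ({ω | 𝒯.alive A ω j = R} ∩ ⋂ B ∈ R, (𝒯.growth U B (P B))ᶜ) :=
        measureReal_biUnion_finset_le _ _
    _ ≤ ∑ R ∈ 𝓡, μ.real {ω | 𝒯.alive A ω j = R} * Real.exp (-q * a) := by
        refine Finset.sum_le_sum fun R hR => ?_
        simp only [h𝓡, Finset.mem_filter, Finset.mem_powerset] at hR
        rw [𝒯.measureReal_inter_biInter R 𝒯.below (𝒯.belowLT A j) ?_ ?_
          (𝒯.measurableSet_alive_eq A j R) fun B _ =>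
            @MeasurableSet.compl _ _ (𝒯.sigmaOn _) (𝒯.measurableSet_growth U B (P B))]
        · refine mul_le_mul_of_nonneg_left ?_ measureReal_nonneg
          have h1 : ∀ B, μ.real (𝒯.growth U B (P B))ᶜ ≤ Real.exp (-q) := by
            intro B
            rw [probReal_compl_eq_one_sub (𝒯.sigmaOn_le _ _ (𝒯.measurableSet_growth U B (P B)))]
            linarith [h B, Real.add_one_le_exp (-q)]
          refine (Finset.prod_le_prod (fun _ _ => measureReal_nonneg) fun B _ => h1 B).trans ?_
          rw [Finset.prod_const, ← Real.exp_nat_mul]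
          apply Real.exp_le_exp.2
          nlinarith [hR.2]
        · intro B hB C hC hne
          refine 𝒯.disjoint_below ?_ hne
          rw [𝒯.lvl_of_mem_desc (hR.1 hB), 𝒯.lvl_of_mem_desc (hR.1 hC)]
        · intro B hB
          rw [Set.disjoint_left]
          intro v hv hv'
          have h1 := 𝒯.lvl_lt_of_mem_belowLT hv
          have h2 := 𝒯.lvl_le_of_mem_below hv'
          rw [𝒯.lvl_of_mem_desc (hR.1 hB)] at h2
          omega
    _ = μ.real (⋃ R ∈ 𝓡, {ω | 𝒯.alive A ω j = R}) * Real.exp (-q * a) := by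
        rw [← Finset.sum_mul, measureReal_biUnion_finset]
        · intro R _ R' _ hne
          rw [Function.onFun, Set.disjoint_left]
          intro ω h1 h2
          exact hne (Eq.trans (Eq.symm h1) h2)
        · exact fun R _ => hmeas R
    _ ≤ Real.exp (-q * a) :=
        mul_le_of_le_one_left (Real.exp_pos _).le measureReal_le_one

/-- If each task has an inheritance structure, and the number of tasks grows at most exponentially
with the level, then almost surely, when the tree is infinite, all the tasks of some level are
successful simultaneously. -/
theorem ae_exists_allTasks [IsProbabilityMeasure μ] (root : V) (hroot : 𝒯.lvl root = 0)
    {T : Type*} (G Γ : ℝ) (U : V → Set X)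
    (Ch : X → V → Finset V)
    (hCh : ∀ x v, x ∈ U v → Ch x v ⊆ 𝒯.children v ∧ 2 ≤ ∑ w ∈ Ch x v, μ.real (𝒯.keep w))
    (P : T → V → ℕ → Set X) (hP : ∀ t A, 𝒯.Inherits U Ch A (P t A) G Γ)
    (hne : ∀ t A j, (P t A j).Nonempty) (t₀ : T) (reps : ℕ → Finset T) (C b : ℝ)
    (hreps : ∀ n, ((reps n).card : ℝ) ≤ C * b ^ n) :
    ∀ᵐ ω ∂μ, (∀ n, (𝒯.alive root ω n).Nonempty) →
      ∃ n, ∀ t ∈ reps n, ∃ B ∈ 𝒯.alive root ω n, ω ∈ 𝒯.growth U B (P t B) := by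
  obtain ⟨q, hq, hgrowth⟩ := 𝒯.exists_le_measureReal_growth G Γ U Ch hCh
  -- The task `t₀` only produces many survivors below `A`, which serve as independent trials for the
  -- other tasks. The depth `j` may depend on `A`; only the bound `q / 2` must not.
  have key : ∀ A, ∃ j, q / 2 ≤ μ.real (𝒯.allTasks U P reps A j) := by
    intro A
    have hlim : Tendsto (fun j : ℕ => (C * b ^ 𝒯.lvl A) * b ^ j * Real.exp (-q * (3 / 2 : ℝ) ^ j))
        atTop (𝓝 0) :=
      (summable_pow_mul_exp_neg_pow _ _ _ _ hq (by norm_num)).tendsto_atTop_zero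
    obtain ⟨j, hj⟩ := (hlim.eventually (gt_mem_nhds (half_pos hq))).exists
    refine ⟨j, ?_⟩
    set bad : T → Set Ω := fun t => {ω | (3 / 2 : ℝ) ^ j ≤ (𝒯.alive A ω j).card ∧
      ∀ B ∈ 𝒯.alive A ω j, ω ∉ 𝒯.growth U B (P t B)}
    have hcover : 𝒯.growth U A (P t₀ A) ⊆
        𝒯.allTasks U P reps A j ∪ ⋃ t ∈ reps (𝒯.lvl A + j), bad t := by
      intro ω hω
      by_contra hcon
      simp only [Set.mem_union, Set.mem_iUnion, not_or, not_exists] at hcon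
      obtain ⟨h1, h2⟩ := hcon
      apply h1
      intro t ht
      by_contra! h3
      refine h2 t ht ⟨?_, h3⟩
      obtain ⟨x, hx⟩ := hne t₀ A j
      refine (hω j x hx).trans (Nat.cast_le.2 (Finset.card_le_card fun v hv => ?_))
      exact (𝒯.mem_hits.1 hv).1
    have h1 : μ.real (⋃ t ∈ reps (𝒯.lvl A + j), bad t) ≤ q / 2 := by
      refine (measureReal_biUnion_finset_le _ _).trans ?_
      refine (Finset.sum_le_sum fun t _ => 𝒯.measureReal_forall_notMem_growth_le U (P t) A j q _ hq.le
        fun B => hgrowth B _ (hP t B)).trans ?_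
      rw [Finset.sum_const, nsmul_eq_mul]
      refine (mul_le_mul_of_nonneg_right (hreps _) (Real.exp_pos _).le).trans ?_
      rw [pow_add, ← mul_assoc]
      exact hj.le
    have h2 := hgrowth A _ (hP t₀ A)
    have h3 : μ.real (𝒯.growth U A (P t₀ A)) ≤ _ :=
      (measureReal_mono hcover).trans (measureReal_union_le _ _)
    linarith
  choose j hj using key
  have := 𝒯.ae_exists_of_le_measureReal root hroot (fun A => 𝒯.allTasks U P reps A (j A))
    (fun A => 𝒯.measurableSet_allTasks U P reps A (j A)) (q / 2) (half_pos hq) hj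
  filter_upwards [this] with ω hω hsurv
  obtain ⟨n, A, hA, hω⟩ := hω hsurv
  refine ⟨n + j A, fun t ht => ?_⟩
  have hl : 𝒯.lvl A = n := by
    rw [𝒯.lvl_of_mem_desc (𝒯.alive_subset_desc _ _ _ hA), hroot, zero_add]
  obtain ⟨B, hB, hgr⟩ := hω t (by rw [hl]; exact ht)
  exact ⟨B, 𝒯.alive_add hA hB, hgr⟩

end BranchingTree

/-! ### Fractal percolation as a branching tree -/

/-- Families of independent events that are indexed by disjoint sets generate independent
`σ`-algebras. -/
theorem iIndepSet_iIndep_generateFrom_of_pairwise_disjoint {Ω ι κ : Type*} [MeasurableSpace Ω]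
    {μ : Measure Ω} {s : ι → Set Ω} (hsm : ∀ i, MeasurableSet (s i)) (hs : iIndepSet s μ)
    (S : κ → Set ι) (hS : ∀ a b, a ≠ b → Disjoint (S a) (S b)) :
    iIndep (fun a => MeasurableSpace.generateFrom
      {t | ∃ F : Finset ι, ↑F ⊆ S a ∧ t = ⋂ i ∈ F, s i}) μ := by
  classical
  refine iIndepSets.iIndep (fun a => MeasurableSpace.generateFrom_le ?_) _ ?_ (fun _ => rfl) ?_
  · rintro t ⟨F, -, rfl⟩
    exact Finset.measurableSet_biInter _ fun i _ => hsm i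
  · rintro a _ ⟨F, hF, rfl⟩ _ ⟨F', hF', rfl⟩ -
    refine ⟨F ∪ F', by simp [hF, hF'], ?_⟩
    ext ω
    simp [or_imp, forall_and]
  · rw [iIndepSets_iff]
    intro Q f hf
    choose! F hF hfF using hf
    have h1 : ⋂ a ∈ Q, f a = ⋂ i ∈ Q.biUnion F, s i := by
      rw [Finset.set_biInter_biUnion]
      exact Set.iInter₂_congr hfF
    rw [h1, hs.meas_biInter, Finset.prod_biUnion]
    · refine Finset.prod_congr rfl fun a ha => ?_
      rw [hfF a ha, hs.meas_biInter]
    · intro a ha b hb hne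
      rw [Function.onFun, ← Finset.disjoint_coe]
      exact (hS a b hne).mono (hF a ha) (hF b hb)

namespace FractalPercolation

variable {Ω : Type*} {d k m M : ℕ}

/-- The label of the cube of level `n` that contains a given cube. -/
def trunc {N : ℕ} (A : Word d M N) (n : ℕ) (h : n ≤ N) : Word d M n := fun i => A (Fin.castLE h i)

/-- The label `(A|D)` of a smaller cube. -/
def join {N N' r : ℕ} (h : N' = N + r) (A : Word d M N) (D : Word d M r) : Word d M N' :=
  fun i => Fin.append A D (Fin.cast h i)

theorem trunc_join {N N' r : ℕ} (h : N' = N + r) (A : Word d M N) (D : Word d M r) :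
    trunc (join h A D) N (by omega) = A := by
  subst h
  ext i : 1
  exact Fin.append_left A D i

theorem join_apply_add {N N' r : ℕ} (h : N' = N + r) (A : Word d M N) (D : Word d M r) (j : Fin r) :
    join h A D ⟨N + j, by omega⟩ = D j := by
  subst h
  exact Fin.append_right A D j

theorem exists_eq_join {N N' r : ℕ} (h : N' = N + r) (B : Word d M N') :
    ∃ D, B = join h (trunc B N (by omega)) D := by
  subst h
  exact ⟨fun j => B (Fin.natAdd N j), (Fin.append_castAdd_natAdd (f := B)).symm⟩

theorem join_injective {N N' r : ℕ} (h : N' = N + r) (A : Word d M N) :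
    Function.Injective (join h A : Word d M r → Word d M N') := by
  intro D D' hD
  ext j : 1
  rw [← join_apply_add h A D j, hD, join_apply_add]

theorem mem_retained_iff (keep : (Σ n : ℕ, Word d M (n + 1)) → Set Ω) (ω : Ω) {N : ℕ}
    (A : Word d M N) :
    A ∈ retained keep ω N ↔ ∀ i (h : i < N), ω ∈ keep ⟨i, trunc A (i + 1) h⟩ := by
  induction N with
  | zero => simp [retained]
  | succ n ih =>
    have : A ∈ retained keep ω (n + 1) ↔
        (Fin.init A : Word d M n) ∈ retained keep ω n ∧ ω ∈ keep ⟨n, A⟩ := Iff.rfl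
    rw [this, ih]
    constructor
    · rintro ⟨h1, h2⟩ i hi
      rcases Nat.lt_succ_iff_lt_or_eq.1 hi with h | rfl
      · exact h1 i h
      · exact h2
    · intro h
      exact ⟨fun i hi => h i (by omega), h n (by omega)⟩

theorem trunc_mem_retained {keep : (Σ n : ℕ, Word d M (n + 1)) → Set Ω} {ω : Ω} {N n : ℕ}
    {A : Word d M N} (h : n ≤ N) (hA : A ∈ retained keep ω N) :
    trunc A n h ∈ retained keep ω n := by
  rw [mem_retained_iff] at hA ⊢
  exact fun i hi => hA i (by omega)

/-- Cubes whose levels are multiples of `r`. -/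
abbrev Block (d M r : ℕ) : Type := Σ n : ℕ, Word d M (n * r)

theorem succ_mul_eq (n r : ℕ) : (n + 1) * r = n * r + r := by ring

namespace Block

variable {r : ℕ}

def par : Block d M r → Block d M r
  | ⟨0, A⟩ => ⟨0, A⟩
  | ⟨n + 1, B⟩ => ⟨n, trunc B (n * r) (by rw [succ_mul_eq]; omega)⟩

/-- The indices of the events that concern the step from a cube to its successors. -/
def ofIndex (r : ℕ) (w : Σ n : ℕ, Word d M (n + 1)) : Block d M r :=
  ⟨w.1 / r, trunc w.2 (w.1 / r * r) ((Nat.div_mul_le_self _ _).trans (by omega))⟩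

/-- The index of the event for the `j`-th cube on the way to a successor. -/
def index {n : ℕ} (B : Word d M ((n + 1) * r)) (j : Fin r) : Σ n : ℕ, Word d M (n + 1) :=
  ⟨n * r + j, trunc B (n * r + j + 1) (by rw [succ_mul_eq]; omega)⟩

/-- The steps towards a successor start at levels `n * r + j` with `j < r`, which round down to the
same block. -/
theorem ofIndex_index (hr : 1 ≤ r) {n : ℕ} (B : Word d M ((n + 1) * r)) (j : Fin r) :
    ofIndex r (index B j) = par ⟨n + 1, B⟩ := by
  have h : (n * r + (j : ℕ)) / r = n := by
    rw [mul_comm, Nat.mul_add_div (by omega), Nat.div_eq_of_lt j.2, add_zero]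
  have : ∀ q (hq : q = n) (h' : q * r ≤ n * r + j + 1),
      (⟨q, trunc (index B j).2 (q * r) h'⟩ : Block d M r) = par ⟨n + 1, B⟩ := by
    rintro q rfl h'
    rfl
  exact this _ h _

theorem index_injective {n : ℕ} (B : Word d M ((n + 1) * r)) : Function.Injective (index B) := by
  intro i j h
  have : n * r + (i : ℕ) = n * r + j := congrArg Sigma.fst h
  ext
  omega

/-- The event that a block is retained given that its predecessor is. -/
def keepAll (keep : (Σ n : ℕ, Word d M (n + 1)) → Set Ω) : Block d M r → Set Ω
  | ⟨0, _⟩ => Set.univ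
  | ⟨_ + 1, B⟩ => ⋂ j : Fin r, keep (index B j)

def level (n : ℕ) : Finset (Block d M r) :=
  Finset.univ.map ⟨Sigma.mk n, sigma_mk_injective⟩

theorem mem_level (n : ℕ) (v : Block d M r) : v ∈ level n ↔ v.1 = n := by
  obtain ⟨n', A⟩ := v
  simp only [level, Finset.mem_map, Finset.mem_univ, true_and, Function.Embedding.coeFn_mk]
  constructor
  · rintro ⟨B, h⟩
    exact (congrArg Sigma.fst h).symm
  · rintro rfl
    exact ⟨A, rfl⟩

def child {n : ℕ} (A : Word d M (n * r)) (D : Word d M r) : Block d M r :=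
  ⟨n + 1, join (succ_mul_eq n r) A D⟩

theorem child_injective {n : ℕ} (A : Word d M (n * r)) :
    Function.Injective (child A : Word d M r → Block d M r) :=
  sigma_mk_injective.comp (join_injective _ A)

theorem par_child {n : ℕ} (A : Word d M (n * r)) (D : Word d M r) : par (child A D) = ⟨n, A⟩ := by
  simp [par, child, trunc_join]

theorem exists_eq_child {n : ℕ} {A : Word d M (n * r)} {w : Block d M r} (h : w.1 = n + 1)
    (h' : par w = ⟨n, A⟩) : ∃ D, w = child A D := by
  obtain ⟨n', B⟩ := w
  obtain rfl : n' = n + 1 := h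
  obtain ⟨D, hD⟩ := exists_eq_join (succ_mul_eq n r) B
  have h1 : trunc B (n * r) (by rw [succ_mul_eq]; omega) = A := by
    simpa [par] using h'
  exact ⟨D, by rw [child, ← h1, ← hD]⟩

variable [MeasurableSpace Ω] {μ : Measure Ω} {p : (Fin d → Fin M) → ℝ}
  {keep : (Σ n : ℕ, Word d M (n + 1)) → Set Ω}

theorem measure_keepAll (hkeep : IsPercolation μ p keep) (hp : ∀ C, 0 ≤ p C)
    {n : ℕ} (A : Word d M (n * r)) (D : Word d M r) :
    μ.real (keepAll keep (child A D)) = ∏ j, p (D j) := by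
  have h := (hkeep.indep.precomp
    (index_injective (join (succ_mul_eq n r) A D))).meas_biInter Finset.univ
  have h1 : keepAll keep (child A D) =
      ⋂ j ∈ Finset.univ, (keep ∘ index (join (succ_mul_eq n r) A D)) j := by
    simp [keepAll, child]
  rw [h1, measureReal_def, h, ENNReal.toReal_prod]
  refine Finset.prod_congr rfl fun j _ => ?_
  rw [Function.comp_apply, hkeep.prob, ENNReal.toReal_ofReal (hp _)]
  congr 1
  exact join_apply_add (succ_mul_eq n r) A D j

/-- Siblings share intermediate cubes, so the indices form an image of which only a cardinality
bound is known; `pm ≤ 1` makes that enough. -/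
theorem pow_le_measure_children (hkeep : IsPercolation μ p keep) {pm : ℝ} (hpm : 0 < pm)
    (hpm1 : pm ≤ 1) (hp : ∀ C, pm ≤ p C) [IsProbabilityMeasure μ] {n : ℕ} (A : Word d M (n * r)) :
    pm ^ (Fintype.card (Word d M r × Fin r)) ≤
      μ.real (⋂ D : Word d M r, keepAll keep (child A D)) := by
  classical
  set I : Finset (Σ n : ℕ, Word d M (n + 1)) :=
    Finset.univ.image fun x : Word d M r × Fin r => index (join (succ_mul_eq n r) A x.1) x.2 with hI
  have h1 : ⋂ D : Word d M r, keepAll keep (child A D) = ⋂ i ∈ I, keep i := by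
    ext ω
    simp only [hI, keepAll, child, Set.mem_iInter, Finset.mem_image, Finset.mem_univ, true_and]
    exact ⟨by rintro h _ ⟨x, rfl⟩; exact h x.1 x.2, fun h D j => h _ ⟨(D, j), rfl⟩⟩
  rw [h1, measureReal_def, hkeep.indep.meas_biInter, ENNReal.toReal_prod]
  calc pm ^ (Fintype.card (Word d M r × Fin r)) ≤ pm ^ I.card :=
        pow_le_pow_of_le_one hpm.le hpm1 Finset.card_image_le
    _ = ∏ i ∈ I, pm := by simp
    _ ≤ _ := Finset.prod_le_prod (fun _ _ => hpm.le) fun i _ => by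
        rw [hkeep.prob, ENNReal.toReal_ofReal (hpm.le.trans (hp _))]
        exact hp _

end Block

/-- Fractal percolation, observed at the levels that are multiples of `r`. -/
noncomputable def blockTree {r : ℕ} (hr : 1 ≤ r) [MeasurableSpace Ω] {μ : Measure Ω}
    [IsProbabilityMeasure μ] {p : (Fin d → Fin M) → ℝ}
    {keep : (Σ n : ℕ, Word d M (n + 1)) → Set Ω} (hkeep : IsPercolation μ p keep) (pm : ℝ)
    (hpm : 0 < pm) (hpm1 : pm ≤ 1) (hp : ∀ C, pm ≤ p C) : BranchingTree μ (Block d M r) where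
  lvl v := v.1
  par := Block.par
  level := Block.level
  mem_level := Block.mem_level
  keep := Block.keepAll keep
  sigma v := MeasurableSpace.generateFrom
    {t | ∃ F : Finset (Σ n : ℕ, Word d M (n + 1)), ↑F ⊆ {w | Block.ofIndex r w = v} ∧
      t = ⋂ i ∈ F, keep i}
  sigma_le v := by
    refine MeasurableSpace.generateFrom_le ?_
    rintro t ⟨F, -, rfl⟩
    exact Finset.measurableSet_biInter _ fun i _ => hkeep.measurableSet i
  indep := iIndepSet_iIndep_generateFrom_of_pairwise_disjoint hkeep.measurableSet hkeep.indep
    (fun v => {w | Block.ofIndex r w = v}) fun a b hab => by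
      rw [Set.disjoint_left]
      rintro w rfl h
      exact hab h
  measurableSet_keep v hv := by
    obtain ⟨_ | n, B⟩ := v
    · exact absurd rfl hv
    · refine MeasurableSpace.measurableSet_generateFrom
        ⟨Finset.univ.image (Block.index B), ?_, by simp [Block.keepAll]⟩
      intro w hw
      obtain ⟨j, -, rfl⟩ := Finset.mem_image.1 (Finset.mem_coe.1 hw)
      exact Block.ofIndex_index hr B j
  bound := Fintype.card (Word d M r)
  card_le v S hS := by
    obtain ⟨n, A⟩ := v
    refine (Finset.card_le_card (t := Finset.univ.image (Block.child A)) fun w hw => ?_).trans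
      Finset.card_image_le
    obtain ⟨D, rfl⟩ := Block.exists_eq_child (hS w hw).1 (hS w hw).2
    simp
  lower := pm ^ (Fintype.card (Word d M r × Fin r))
  lower_pos := pow_pos hpm _
  lower_le v := by
    obtain ⟨n, A⟩ := v
    refine (Block.pow_le_measure_children hkeep hpm hpm1 hp A).trans (measureReal_mono ?_)
    intro ω hω
    simp only [Set.mem_iInter] at hω ⊢
    intro w hw
    obtain ⟨D, rfl⟩ := Block.exists_eq_child hw.1 hw.2
    exact hω D

section

variable {r : ℕ} (hr : 1 ≤ r) [MeasurableSpace Ω] {μ : Measure Ω}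
  [IsProbabilityMeasure μ] {p : (Fin d → Fin M) → ℝ}
  {keep : (Σ n : ℕ, Word d M (n + 1)) → Set Ω} (hkeep : IsPercolation μ p keep) (pm : ℝ)
  (hpm : 0 < pm) (hpm1 : pm ≤ 1) (hp : ∀ C, pm ≤ p C)

def Block.root (d M r : ℕ) : Block d M r :=
  ⟨0, fun i => (Nat.not_lt_zero i (by simpa using i.2)).elim⟩

theorem mem_alive_blockTree_iff (ω : Ω) {n : ℕ} (B : Word d M (n * r)) :
    (⟨n, B⟩ : Block d M r) ∈
      (blockTree hr hkeep pm hpm hpm1 hp).alive (Block.root d M r) ω n ↔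
    B ∈ retained keep ω (n * r) := by
  rw [mem_retained_iff]
  induction n with
  | zero =>
    have h0 : ∀ i, ¬ i < 0 * r := by simp
    simp only [BranchingTree.alive, Finset.mem_singleton, Block.root]
    refine ⟨fun _ i h => absurd h (h0 i), fun _ => ?_⟩
    congr
    ext i
    exact absurd i.2 (h0 i)
  | succ n ih =>
    have hle : n * r ≤ (n + 1) * r := by rw [succ_mul_eq]; omega
    rw [BranchingTree.mem_alive_succ]
    constructor
    · rintro ⟨⟨n', A⟩, hA, hB, hk⟩ i hi
      obtain ⟨h1, h2⟩ := (BranchingTree.mem_children _).1 hB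
      have h2' : (⟨n, trunc B (n * r) hle⟩ : Block d M r) = ⟨n', A⟩ := h2
      rw [← h2', ih] at hA
      rcases lt_or_ge i (n * r) with h | h
      · exact hA i h
      · have h3 : ω ∈ ⋂ j : Fin r, keep (Block.index B j) := hk
        rw [succ_mul_eq] at hi
        obtain ⟨j, rfl⟩ : ∃ j, i = n * r + j := ⟨i - n * r, by omega⟩
        exact Set.mem_iInter.1 h3 ⟨j, by omega⟩
    · intro h
      refine ⟨⟨n, trunc B (n * r) hle⟩, (ih _).2 fun i hi => h i (by omega),
        (BranchingTree.mem_children _).2 ⟨rfl, rfl⟩, ?_⟩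
      exact Set.mem_iInter.2 fun j => h (n * r + j) (by rw [succ_mul_eq]; omega)

theorem alive_nonempty_of_retained (ω : Ω) (h : ∀ n, (retained keep ω n : Set (Word d M n)).Nonempty)
    (n : ℕ) : ((blockTree hr hkeep pm hpm hpm1 hp).alive (Block.root d M r) ω n).Nonempty := by
  obtain ⟨B, hB⟩ := h (n * r)
  exact ⟨_, (mem_alive_blockTree_iff hr hkeep pm hpm hpm1 hp ω B).2 hB⟩

end

end FractalPercolation

/-! ### Geometry of cubes, projections, Condition A and nets -/

namespace FractalPercolation

variable {d k m M : ℕ}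

/-- The largest digits telescope; the slack `(M ^ n)⁻¹` is the side of the cube, which keeps it
inside `K`. -/
theorem sum_digits_le (hM : 1 ≤ M) {n : ℕ} (D : Fin n → Fin M) :
    ∑ j, ((D j : ℕ) : ℝ) / (M : ℝ) ^ ((j : ℕ) + 1) ≤ 1 - ((M : ℝ) ^ n)⁻¹ := by
  have hM0 : (0 : ℝ) < M := by exact_mod_cast hM
  induction n with
  | zero => simp
  | succ n ih =>
    rw [Fin.sum_univ_castSucc]
    have h1 := ih fun j => D j.castSucc
    have h2 : ((D (Fin.last n) : ℕ) : ℝ) ≤ M - 1 := by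
      have : (D (Fin.last n) : ℕ) + 1 ≤ M := (D (Fin.last n)).2
      have : (((D (Fin.last n) : ℕ) + 1 : ℕ) : ℝ) ≤ M := by exact_mod_cast this
      push_cast at this
      linarith
    have h3 : ((D (Fin.last n) : ℕ) : ℝ) / (M : ℝ) ^ (n + 1) ≤
        ((M : ℝ) ^ n)⁻¹ - ((M : ℝ) ^ (n + 1))⁻¹ := by
      rw [div_le_iff₀ (by positivity)]
      refine h2.trans (le_of_eq ?_)
      rw [pow_succ]
      field_simp
    simp only [Fin.val_castSucc, Fin.val_last] at h1 ⊢
    linarith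

theorem isCompact_unitCube (d : ℕ) : IsCompact (unitCube d) := by
  have : unitCube d = WithLp.toLp 2 '' (Set.Icc (0 : Fin d → ℝ) 1) := by
    ext x
    simp only [unitCube, Set.mem_ofPred_eq, Set.mem_image, Set.mem_Icc, Pi.le_def]
    constructor
    · exact fun h => ⟨x.ofLp, ⟨fun i => (h i).1, fun i => (h i).2⟩, rfl⟩
    · rintro ⟨y, hy, rfl⟩ i
      exact ⟨hy.1 i, hy.2 i⟩
  rw [this]
  exact isCompact_Icc.image (PiLp.continuous_toLp 2 _)

theorem zero_mem_unitCube (d : ℕ) : (0 : Space d) ∈ unitCube d := fun i => by simp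

theorem continuous_phi {n : ℕ} (A : Word d M n) : Continuous (phi A) := by
  unfold phi
  fun_prop

theorem isCompact_cube {n : ℕ} (A : Word d M n) : IsCompact (cube A) :=
  (isCompact_unitCube d).image (continuous_phi A)

theorem corner_mem_cube {n : ℕ} (A : Word d M n) : corner A ∈ cube A :=
  ⟨0, zero_mem_unitCube d, by simp [phi]⟩

theorem phi_mem_unitCube (hM : 1 ≤ M) {n : ℕ} (A : Word d M n) {x : Space d}
    (hx : x ∈ unitCube d) : phi A x ∈ unitCube d := by
  intro i
  have h1 := sum_digits_le hM fun j => A j i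
  have h2 : 0 ≤ ∑ j, ((A j i : ℕ) : ℝ) / (M : ℝ) ^ ((j : ℕ) + 1) :=
    Finset.sum_nonneg fun j _ => by positivity
  have h3 : (phi A x) i = ((M : ℝ) ^ n)⁻¹ * x i +
      ∑ j, ((A j i : ℕ) : ℝ) / (M : ℝ) ^ ((j : ℕ) + 1) := by
    simp [phi, corner]
  have h4 : 0 ≤ ((M : ℝ) ^ n)⁻¹ := by positivity
  obtain ⟨h5, h6⟩ := hx i
  rw [h3]
  constructor
  · positivity
  · nlinarith

theorem cube_subset_unitCube (hM : 1 ≤ M) {n : ℕ} (A : Word d M n) : cube A ⊆ unitCube d := by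
  rintro _ ⟨x, hx, rfl⟩
  exact phi_mem_unitCube hM A hx

theorem corner_mem_unitCube (hM : 1 ≤ M) {n : ℕ} (A : Word d M n) : corner A ∈ unitCube d :=
  cube_subset_unitCube hM A (corner_mem_cube A)

theorem corner_join (hM : 1 ≤ M) {N N' r : ℕ} (h : N' = N + r) (A : Word d M N)
    (D : Word d M r) : corner (join h A D) = corner A + ((M : ℝ) ^ N)⁻¹ • corner D := by
  subst h
  have hM0 : (M : ℝ) ≠ 0 := by exact_mod_cast (by omega : M ≠ 0)
  ext i
  simp only [corner, join, Fin.cast_refl, id, Fin.sum_univ_add, Fin.append_left, Fin.append_right,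
    PiLp.add_apply, PiLp.smul_apply, Fin.val_castAdd, Fin.val_natAdd, smul_eq_mul, Finset.mul_sum]
  congr 1
  refine Finset.sum_congr rfl fun j _ => ?_
  rw [add_assoc, pow_add]
  field_simp

theorem phi_join (hM : 1 ≤ M) {N N' r : ℕ} (h : N' = N + r) (A : Word d M N)
    (D : Word d M r) (x : Space d) : phi (join h A D) x = phi A (phi D x) := by
  rw [phi, corner_join hM, phi, phi, h, pow_add, mul_inv, smul_add, smul_smul]
  abel

theorem cube_join_subset (hM : 1 ≤ M) {N N' r : ℕ} (h : N' = N + r) (A : Word d M N)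
    (D : Word d M r) : cube (join h A D) ⊆ cube A := by
  rintro _ ⟨x, hx, rfl⟩
  exact ⟨phi D x, phi_mem_unitCube hM D hx, (phi_join hM h A D x).symm⟩

theorem cube_subset_cube_trunc (hM : 1 ≤ M) {N n : ℕ} (h : n ≤ N) (A : Word d M N) :
    cube A ⊆ cube (trunc A n h) := by
  obtain ⟨D, hD⟩ := exists_eq_join (show N = n + (N - n) by omega) A
  conv_lhs => rw [hD]
  exact cube_join_subset hM _ _ _

/-! ### The projections are linear -/

theorem incl_add (x y : Space k) : incl k m (x + y) = incl k m x + incl k m y := by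
  ext i
  refine Fin.addCases (fun i => ?_) (fun i => ?_) i <;> simp [incl]

theorem incl_smul (c : ℝ) (x : Space k) : incl k m (c • x) = c • incl k m x := by
  ext i
  refine Fin.addCases (fun i => ?_) (fun i => ?_) i <;> simp [incl]

/-- The nonzero minor means that a vector of `S_αᗮ` is determined by its last `m` coordinates. This
is the uniqueness behind `planeProj`. -/
theorem eq_zero_of_incl_mem {a : Frame (k + m) k} (ha : a ∈ chart k m) {y : Space k}
    (hy : incl k m y ∈ (plane a)ᗮ) : y = 0 := by
  obtain ⟨c, -, hspan, hdet⟩ := ha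
  set B : Matrix (Fin m) (Fin m) ℝ := Matrix.of fun i j => c j (Fin.natAdd k i) with hB
  have hdet' : B.det ≠ 0 := by
    intro h
    rw [h, abs_zero] at hdet
    exact absurd hdet (not_lt.2 (by positivity))
  rw [← hspan, Submodule.mem_span_range_iff_exists_fun] at hy
  obtain ⟨l, hl⟩ := hy
  have h1 : B.mulVec l = 0 := by
    ext i
    have h2 := congrArg (fun z : Space (k + m) => z (Fin.natAdd k i)) hl
    simp only [incl, Fin.append_right, WithLp.ofLp_sum, WithLp.ofLp_smul, Finset.sum_apply,
      Pi.smul_apply, smul_eq_mul] at h2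
    simp only [Matrix.mulVec, dotProduct, hB, Matrix.of_apply, Pi.zero_apply]
    rw [← h2]
    exact Finset.sum_congr rfl fun j _ => mul_comm _ _
  have h2 := Matrix.eq_zero_of_mulVec_eq_zero hdet' h1
  ext i
  have h3 := congrArg (fun z : Space (k + m) => z (Fin.castAdd m i)) hl
  simpa [h2, incl] using h3.symm

/-- Invert the minor to find the vector of `S_αᗮ` that cancels the last `m` coordinates of `x`. -/
theorem exists_incl_sub_mem {a : Frame (k + m) k} (ha : a ∈ chart k m) (x : Space (k + m)) :
    ∃ y : Space k, incl k m y - x ∈ (plane a)ᗮ := by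
  obtain ⟨c, -, hspan, hdet⟩ := ha
  set B : Matrix (Fin m) (Fin m) ℝ := Matrix.of fun i j => c j (Fin.natAdd k i) with hB
  have hdet' : IsUnit B.det := by
    rw [isUnit_iff_ne_zero]
    intro h
    rw [h, abs_zero] at hdet
    exact absurd hdet (not_lt.2 (by positivity))
  set l : Fin m → ℝ := B⁻¹.mulVec fun i => -x (Fin.natAdd k i) with hl
  have h1 : B.mulVec l = fun i => -x (Fin.natAdd k i) := by
    rw [hl, Matrix.mulVec_mulVec, Matrix.mul_nonsing_inv _ hdet', Matrix.one_mulVec]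
  set z : Space (k + m) := ∑ j, l j • c j with hz
  refine ⟨WithLp.toLp 2 fun i => (x + z) (Fin.castAdd m i), ?_⟩
  have h2 : incl k m (WithLp.toLp 2 fun i => (x + z) (Fin.castAdd m i)) - x = z := by
    ext i
    refine Fin.addCases (fun i => ?_) (fun i => ?_) i
    · simp [incl]
    · have h3 := congrFun h1 i
      simp only [Matrix.mulVec, dotProduct, hB, Matrix.of_apply] at h3
      simp only [incl, PiLp.sub_apply, Fin.append_right, hz, WithLp.ofLp_sum, WithLp.ofLp_smul,
        Finset.sum_apply, Pi.smul_apply, smul_eq_mul, zero_sub]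
      rw [← h3]
      exact Finset.sum_congr rfl fun j _ => mul_comm _ _
  rw [h2, ← hspan, hz]
  exact Submodule.sum_mem _ fun j _ => Submodule.smul_mem _ _ (Submodule.subset_span ⟨j, rfl⟩)

theorem incl_planeProj_sub_mem {a : Frame (k + m) k} (ha : a ∈ chart k m) (x : Space (k + m)) :
    incl k m (planeProj a x) - x ∈ (plane a)ᗮ :=
  Classical.epsilon_spec (exists_incl_sub_mem ha x)

theorem planeProj_eq {a : Frame (k + m) k} (ha : a ∈ chart k m) {x : Space (k + m)} {y : Space k}
    (h : incl k m y - x ∈ (plane a)ᗮ) : planeProj a x = y := by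
  have h1 := Submodule.sub_mem _ (incl_planeProj_sub_mem ha x) h
  rw [← sub_eq_zero]
  refine eq_zero_of_incl_mem ha ?_
  have : incl k m (planeProj a x - y) = incl k m (planeProj a x) - x - (incl k m y - x) := by
    rw [sub_eq_add_neg, ← neg_one_smul ℝ y, incl_add, incl_smul]
    module
  rwa [this]

/-- `planeProj` as a linear map. -/
noncomputable def projLinear {a : Frame (k + m) k} (ha : a ∈ chart k m) :
    Space (k + m) →ₗ[ℝ] Space k where
  toFun := planeProj a
  map_add' x y := by
    refine planeProj_eq ha ?_
    have := Submodule.add_mem _ (incl_planeProj_sub_mem ha x) (incl_planeProj_sub_mem ha y)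
    rw [incl_add]
    convert this using 1
    abel
  map_smul' c x := by
    refine planeProj_eq ha ?_
    have := Submodule.smul_mem _ c (incl_planeProj_sub_mem ha x)
    rw [RingHom.id_apply, incl_smul, ← smul_sub]
    exact this

theorem planeProj_add {a : Frame (k + m) k} (ha : a ∈ chart k m) (x y : Space (k + m)) :
    planeProj a (x + y) = planeProj a x + planeProj a y := (projLinear ha).map_add x y

theorem planeProj_smul {a : Frame (k + m) k} (ha : a ∈ chart k m) (c : ℝ) (x : Space (k + m)) :
    planeProj a (c • x) = c • planeProj a x := (projLinear ha).map_smul c x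

theorem continuous_planeProj {a : Frame (k + m) k} (ha : a ∈ chart k m) :
    Continuous (planeProj a) := (projLinear ha).continuous_of_finiteDimensional

theorem planeProj_phi (hM : 1 ≤ M) {a : Frame (k + m) k} (ha : a ∈ chart k m) {n : ℕ}
    (A : Word (k + m) M n) {x : Space (k + m)} {y : Space k} (h : planeProj a x = psi a A y) :
    planeProj a (phi A x) = y := by
  have hM0 : (M : ℝ) ^ n ≠ 0 := pow_ne_zero _ (by exact_mod_cast (by omega : M ≠ 0))
  rw [phi, planeProj_add ha, planeProj_smul ha, h, psi, inv_smul_smul₀ hM0, sub_add_cancel]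

theorem psi_join (hM : 1 ≤ M) {a : Frame (k + m) k} (ha : a ∈ chart k m) {N N' r : ℕ}
    (h : N' = N + r) (A : Word (k + m) M N) (D : Word (k + m) M r) (y : Space k) :
    psi a (join h A D) y = psi a D (psi a A y) := by
  have hM0 : (M : ℝ) ^ N ≠ 0 := pow_ne_zero _ (by exact_mod_cast (by omega : M ≠ 0))
  rw [psi, corner_join hM, planeProj_add ha, planeProj_smul ha, psi, psi, h, pow_add, mul_comm,
    ← smul_smul]
  congr 1
  rw [← sub_sub, smul_sub _ (_ - _), smul_inv_smul₀ hM0]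

theorem continuous_psi {n : ℕ} (a : Frame (k + m) k) (A : Word (k + m) M n) :
    Continuous (psi a A) := by
  unfold psi
  fun_prop

theorem psi_inv (hM : 1 ≤ M) {n : ℕ} (a : Frame (k + m) k) (A : Word (k + m) M n) (e : Space k) :
    psi a A (((M : ℝ) ^ n)⁻¹ • e + planeProj a (corner A)) = e := by
  have hM0 : (M : ℝ) ^ n ≠ 0 := pow_ne_zero _ (by exact_mod_cast (by omega : M ≠ 0))
  rw [psi, add_sub_cancel_right, smul_inv_smul₀ hM0]

/-! ### Condition A -/

/-- For nonnegative `f`, dropping the restriction `x ∈ Π_α(K_C)` can only increase the sum, so an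
upper bound by a plain sum over words suffices. -/
theorem opF_iterate_le (hM : 1 ≤ M) {a : Frame (k + m) k} (ha : a ∈ chart k m)
    {p : (Fin (k + m) → Fin M) → ℝ} (hp : ∀ C, 0 ≤ p C) (r : ℕ) (f : Space k → ℝ)
    (hf : ∀ x, 0 ≤ f x) (x : Space k) :
    (opF p a)^[r] f x ≤ ∑ D : Word (k + m) M r, (∏ j, p (D j)) * f (psi a D x) := by
  have hF : ∀ f : Space k → ℝ, (∀ x, 0 ≤ f x) → ∀ x, 0 ≤ opF p a f x ∧
      opF p a f x ≤ ∑ C, p C * f (psi a (fun _ : Fin 1 => C) x) := by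
    intro f hf x
    unfold opF
    constructor
    · refine Finset.sum_nonneg fun C _ => ?_
      split_ifs
      exacts [mul_nonneg (hp C) (hf _), le_rfl]
    · refine Finset.sum_le_sum fun C _ => ?_
      split_ifs
      exacts [le_rfl, mul_nonneg (hp C) (hf _)]
  induction r generalizing f with
  | zero =>
    rw [Fintype.sum_unique]
    refine le_of_eq ?_
    have : (default : Word (k + m) M 0) = fun i => i.elim0 := by ext i; exact i.elim0
    simp only [Function.iterate_zero, id, Finset.univ_eq_empty, Finset.prod_empty, one_mul]
    congr 1
    have h0 : corner (default : Word (k + m) M 0) = 0 := by ext i; simp [corner]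
    have h1 : planeProj a 0 = 0 := (projLinear ha).map_zero
    rw [psi, h0, h1]
    simp
  | succ r ih =>
    -- The operator applied first to `f` contributes the last letter, hence the matching with
    -- `Fin.snoc` below.
    rw [Function.iterate_succ_apply]
    refine (ih (opF p a f) fun x => (hF f hf x).1).trans ?_
    have h1 : ∀ D : Word (k + m) M r, (∏ j, p (D j)) * opF p a f (psi a D x) ≤
        ∑ C, (∏ j, p (D j)) * p C * f (psi a (join (rfl : r + 1 = r + 1) D fun _ => C) x) := by
      intro D
      refine (mul_le_mul_of_nonneg_left (hF f hf _).2 (Finset.prod_nonneg fun _ _ => hp _)).trans ?_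
      rw [Finset.mul_sum]
      refine Finset.sum_le_sum fun C _ => ?_
      rw [psi_join hM ha, mul_assoc]
    refine (Finset.sum_le_sum fun D _ => h1 D).trans (le_of_eq ?_)
    rw [← Fintype.sum_prod_type'
      (f := fun (D : Word (k + m) M r) C => (∏ j, p (D j)) * p C *
        f (psi a (join (rfl : r + 1 = r + 1) D fun _ => C) x))]
    refine Fintype.sum_equiv ((Equiv.prodComm _ _).trans (Fin.snocEquiv fun _ => Fin (k + m) → Fin M))
      _ _ fun DC => ?_
    obtain ⟨D, C⟩ := DC
    have h2 : (Fin.snocEquiv fun _ => Fin (k + m) → Fin M) (C, D) =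
        (join (rfl : r + 1 = r + 1) D fun _ => C) := by
      ext j : 1
      refine Fin.lastCases ?_ (fun j => ?_) j
      · simp only [Fin.snocEquiv, Equiv.coe_fn_mk, Fin.snoc_last]
        exact (join_apply_add (rfl : r + 1 = r + 1) D (fun _ => C) 0).symm
      · simp only [Fin.snocEquiv, Equiv.coe_fn_mk, Fin.snoc_castSucc]
        exact (congrFun (trunc_join (rfl : r + 1 = r + 1) D (fun _ => C)) j).symm
    have h3 : ((Equiv.prodComm _ _).trans (Fin.snocEquiv fun _ => Fin (k + m) → Fin M)) (D, C) =
        (Fin.snocEquiv fun _ => Fin (k + m) → Fin M) (C, D) := rfl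
    rw [h3, ← h2, Fin.prod_univ_castSucc]
    simp [Fin.snocEquiv]

/-- The products are the survival probabilities of blocks, so this bounds the mean number of
surviving successors. -/
theorem ConditionA.two_le_sum (hM : 1 ≤ M) {a : Frame (k + m) k} (ha : a ∈ chart k m)
    {p : (Fin (k + m) → Fin M) → ℝ} (hp : ∀ C, 0 ≤ p C) {I₁ I₂ : Set (Space k)} {r : ℕ}
    (h : ConditionA p I₁ I₂ r a) {x : Space k} (hx : x ∈ I₂)
    [DecidablePred fun D : Word (k + m) M r => psi a D x ∈ I₁] :
    2 ≤ ∑ D ∈ Finset.univ.filter fun D : Word (k + m) M r => psi a D x ∈ I₁, ∏ j, p (D j) := by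
  have h1 := h.ineq x
  rw [Set.indicator_of_mem hx, mul_one] at h1
  refine (h1.trans (opF_iterate_le hM ha hp r _
    (fun x => Set.indicator_nonneg (fun _ _ => zero_le_one) x) x)).trans (le_of_eq ?_)
  rw [Finset.sum_filter]
  refine Finset.sum_congr rfl fun D _ => ?_
  split_ifs with hD
  · rw [Set.indicator_of_mem hD, mul_one]
  · rw [Set.indicator_of_notMem hD, mul_zero]

theorem ConditionA.nonempty (hM : 1 ≤ M) {a : Frame (k + m) k} (ha : a ∈ chart k m)
    {p : (Fin (k + m) → Fin M) → ℝ} (hp : ∀ C, 0 ≤ p C) {I₁ I₂ : Set (Space k)} {r : ℕ}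
    (h : ConditionA p I₁ I₂ r a) (hne : I₂.Nonempty) : I₁.Nonempty := by
  classical
  obtain ⟨x, hx⟩ := hne
  have h1 := h.two_le_sum hM ha hp hx
  by_contra hcon
  rw [Set.not_nonempty_iff_eq_empty] at hcon
  simp [hcon] at h1
  linarith

/-! ### The collar -/

theorem mem_of_dist_lt_gap {I₁ I₂ : Set (Space k)} {x y : Space k} (hx : x ∈ I₁)
    (h : dist x y < gap I₁ I₂) : y ∈ I₂ := by
  by_contra hy
  refine absurd h (not_lt.2 (csInf_le ⟨0, ?_⟩ ⟨x, hx, y, hy, rfl⟩))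
  rintro _ ⟨_, _, _, _, rfl⟩
  exact dist_nonneg

/-- Compactness of `I₁` gives a uniform collar. The complement of `I₂` must be nonempty, as `sInf ∅
= 0`; here `1 ≤ k` enters. -/
theorem gap_pos (hk : 1 ≤ k) {I₁ I₂ : Set (Space k)} (h₁ : IsCompact I₁) (h₂ : IsCompact I₂)
    (hne : I₁.Nonempty) (h : I₁ ⊆ interior I₂) : 0 < gap I₁ I₂ := by
  obtain ⟨δ, hδ, hsub⟩ := h₁.exists_thickening_subset_open isOpen_interior h
  refine lt_of_lt_of_le hδ (le_csInf ?_ ?_)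
  · have : Nonempty (Fin k) := ⟨⟨0, hk⟩⟩
    have : NoncompactSpace (Space k) := NormedSpace.noncompactSpace ℝ _
    obtain ⟨x, hx⟩ := hne
    obtain ⟨y, hy⟩ := (Set.ne_univ_iff_exists_notMem I₂).1 h₂.ne_univ
    exact ⟨_, x, hx, y, hy, rfl⟩
  · rintro _ ⟨x, hx, y, hy, rfl⟩
    by_contra! hlt
    exact hy (interior_subset (hsub (Metric.mem_thickening_iff.2 ⟨x, hx, by rwa [dist_comm]⟩)))

/-! ### Nets -/

/-- One point of `I` is chosen in each cell of mesh `1 / N` that meets `I`, with `N = N₀ * Q ^ j`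
and `N₀ > √k / ρ`. The net lies in `I` because its points must themselves be followed. -/
theorem exists_nets {I : Set (Space k)} (hI : IsCompact I) {ρ : ℝ} (hρ : 0 < ρ) (Q : ℕ)
    (hQ : 1 ≤ Q) : ∃ G Γ : ℕ, ∀ j : ℕ, ∃ E : Finset (Space k), ↑E ⊆ I ∧ E.card ≤ G * Γ ^ j ∧
      ∀ y ∈ I, ∃ e ∈ E, dist y e < ρ / (Q : ℝ) ^ j := by
  classical
  obtain ⟨R, hR⟩ := hI.isBounded.exists_norm_le
  obtain ⟨R', hR'⟩ := exists_nat_ge R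
  obtain ⟨N₀, hN₀⟩ := exists_nat_gt (Real.sqrt k / ρ)
  have hN₀pos : (0 : ℝ) < N₀ := lt_of_le_of_lt (by positivity) hN₀
  have hQ0 : (1 : ℝ) ≤ Q := by exact_mod_cast hQ
  refine ⟨(2 * N₀ * R' + 1) ^ k, Q ^ k, fun j => ?_⟩
  set N : ℕ := N₀ * Q ^ j with hN
  have hNpos : (0 : ℝ) < N := by rw [hN]; push_cast; positivity
  set g : Space k → Fin k → ℤ := fun y i => ⌊(N : ℝ) * y i⌋ with hg
  set box : Finset (Fin k → ℤ) := Fintype.piFinset fun _ => Finset.Ico (-(N * R' : ℤ)) (N * R' + 1)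
  have hbox : ∀ y ∈ I, g y ∈ box := by
    intro y hy
    rw [Fintype.mem_piFinset]
    intro i
    have h1 : |y i| ≤ R' := by
      rw [← Real.norm_eq_abs]
      exact (PiLp.norm_apply_le y i).trans ((hR y hy).trans hR')
    rw [abs_le] at h1
    rw [Finset.mem_Ico, Int.le_floor, Int.floor_lt]
    push_cast
    constructor <;> nlinarith
  have hrep : ∀ z : Fin k → ℤ, ∃ y : Space k, (∃ y' ∈ I, g y' = z) → y ∈ I ∧ g y = z := by
    intro z
    by_cases h : ∃ y' ∈ I, g y' = z
    · obtain ⟨y, hy⟩ := h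
      exact ⟨y, fun _ => hy⟩
    · exact ⟨0, fun h' => absurd h' h⟩
  choose rep hrep using hrep
  refine ⟨(box.filter fun z => ∃ y' ∈ I, g y' = z).image rep, ?_, ?_, ?_⟩
  · intro y hy
    obtain ⟨z, hz, rfl⟩ := Finset.mem_image.1 (Finset.mem_coe.1 hy)
    exact (hrep z (Finset.mem_filter.1 hz).2).1
  · refine Finset.card_image_le.trans ((Finset.card_filter_le _ _).trans ?_)
    rw [Fintype.card_piFinset_const, Int.card_Ico, ← pow_mul, mul_comm k j, pow_mul, ← mul_pow]
    refine Nat.pow_le_pow_left ?_ _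
    have h1 : ((N * R' + 1 : ℤ) - -(N * R')).toNat = 2 * (N * R') + 1 := by
      have : ((N * R' + 1 : ℤ) - -(N * R')) = ((2 * (N * R') + 1 : ℕ) : ℤ) := by push_cast; ring
      rw [this, Int.toNat_natCast]
    rw [h1, hN]
    have : 1 ≤ Q ^ j := Nat.one_le_pow _ _ hQ
    nlinarith
  · intro y hy
    obtain ⟨h1, h2⟩ := hrep (g y) ⟨y, hy, rfl⟩
    refine ⟨rep (g y), Finset.mem_image_of_mem _ (Finset.mem_filter.2 ⟨hbox y hy, y, hy, rfl⟩), ?_⟩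
    have h3 : ∀ i, dist (y i) (rep (g y) i) ≤ 1 / N := by
      intro i
      have h4 : ⌊(N : ℝ) * y i⌋ = ⌊(N : ℝ) * rep (g y) i⌋ := (congrFun h2 i).symm
      have h5 := Int.abs_sub_lt_one_of_floor_eq_floor h4
      rw [← mul_sub, abs_mul, abs_of_pos hNpos] at h5
      rw [Real.dist_eq, le_div_iff₀ hNpos, mul_comm]
      exact h5.le
    have h6 : dist y (rep (g y)) ≤ Real.sqrt k * (1 / N) := by
      rw [EuclideanSpace.dist_eq]
      refine Real.sqrt_le_iff.2 ⟨by positivity, ?_⟩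
      refine (Finset.sum_le_sum fun i _ => pow_le_pow_left₀ dist_nonneg (h3 i) 2).trans ?_
      simp [mul_pow]
    refine lt_of_le_of_lt h6 ?_
    rw [div_lt_iff₀ hρ] at hN₀
    rw [hN, mul_one_div, div_lt_div_iff₀ (by positivity) (by positivity)]
    push_cast
    have : (0 : ℝ) < (Q : ℝ) ^ j := by positivity
    nlinarith

end FractalPercolation

/-! ### Relevant cubes for almost linear families -/

namespace FractalPercolation

variable {k m M : ℕ} {T : Type*} {α : T → Space (k + m) → Frame (k + m) k}
  {J : Set (Frame (k + m) k)} {c δ : ℝ} {r : ℕ} {I₁ I₂ : Set (Space k)}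
  {S : T → Space (k + m) → Space k}

/-- A point whose relevant cubes never die out belongs to the projection of the limit set. -/
theorem mem_image_limitSet {Ω : Type*} (hM : 2 ≤ M) (hr : 1 ≤ r) (hJ : J ⊆ chart k m)
    (hc : IsRobustnessConst J c) (hα : IsAlmostLinear M J c δ r S α)
    (hI₂ : ∀ a ∈ J, I₂ ⊆ shadow a)
    (keep : (Σ n : ℕ, Word (k + m) M (n + 1)) → Set Ω) (ω : Ω) (t : T) (y : Space k) (n₀ : ℕ)
    (h : ∀ n ≥ n₀, ∃ B ∈ retained keep ω (n * r), psi (α t (corner B)) B y ∈ I₂) :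
    y ∈ S t '' limitSet keep ω := by
  have hM1 : 1 ≤ M := by omega
  -- Each relevant cube contains a point projected to `y`, though in the direction attached to its
  -- corner. A limit `x` of such points will be the preimage of `y`.
  have h' : ∀ i, ∃ B ∈ retained keep ω ((n₀ + i) * r), ∃ u ∈ unitCube (k + m),
      planeProj (α t (corner B)) (phi B u) = y := by
    intro i
    obtain ⟨B, hB, hy⟩ := h (n₀ + i) (by omega)
    have haJ := hα.mem t (corner B) (corner_mem_unitCube hM1 B)
    obtain ⟨u, hu, hy⟩ := hI₂ _ haJ hy
    exact ⟨B, hB, u, hu, planeProj_phi hM1 (hJ haJ) B hy⟩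
  choose B hB u hu hy using h'
  obtain ⟨x, hx, φ, hφ, hlim⟩ := (isCompact_unitCube (k + m)).tendsto_subseq
    fun i => phi_mem_unitCube hM1 (B i) (hu i)
  have hcorner : Tendsto (fun i => corner (B (φ i))) atTop (𝓝 x) := by
    obtain ⟨R, hR⟩ := (isCompact_unitCube (k + m)).isBounded.exists_norm_le
    have h1 : Tendsto (fun i => ((M : ℝ) ^ ((n₀ + φ i) * r))⁻¹ • u (φ i)) atTop (𝓝 0) := by
      refine squeeze_zero_norm (a := fun i => ((M : ℝ)⁻¹) ^ ((n₀ + φ i) * r) * R) (fun i => ?_) ?_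
      · rw [norm_smul, norm_inv, norm_pow, Real.norm_natCast, inv_pow]
        exact mul_le_mul_of_nonneg_left (hR _ (hu _)) (by positivity)
      · rw [← zero_mul R]
        refine Tendsto.mul_const _ ?_
        have h2 : (M : ℝ)⁻¹ < 1 := inv_lt_one_of_one_lt₀ (by exact_mod_cast (by omega : 1 < M))
        refine (tendsto_pow_atTop_nhds_zero_of_lt_one (by positivity) h2).comp ?_
        refine tendsto_atTop_mono (fun i => ?_) tendsto_id
        have h3 := hφ.id_le i
        simp only [id] at h3 ⊢
        nlinarith
    have h2 := hlim.sub h1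
    rw [sub_zero] at h2
    refine h2.congr fun i => ?_
    simp only [Function.comp_apply, phi]
    abel
  have hxJ := hα.mem t x hx
  refine ⟨x, ?_, ?_⟩
  · rw [limitSet, Set.mem_iInter]
    intro N
    have hclosed : IsClosed (⋃ A ∈ (retained keep ω N : Set (Word (k + m) M N)), cube A) :=
      Set.Finite.isClosed_biUnion (Set.toFinite _) fun A _ => (isCompact_cube A).isClosed
    refine hclosed.mem_of_tendsto hlim ?_
    filter_upwards [eventually_ge_atTop N] with i hi
    have hN : N ≤ (n₀ + φ i) * r := by
      have h3 := hφ.id_le i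
      simp only [id] at h3
      nlinarith
    exact Set.mem_biUnion (trunc_mem_retained hN (hB (φ i)))
      (cube_subset_cube_trunc hM1 hN _ ⟨u (φ i), hu _, rfl⟩)
  · rw [hα.eq_proj t x hx]
    have h1 : Tendsto (fun i => planeProj (α t x) (phi (B (φ i)) (u (φ i)))) atTop
        (𝓝 (planeProj (α t x) x)) :=
      ((continuous_planeProj (hJ hxJ)).tendsto x).comp hlim
    -- The corners tend to `x`, so the Lipschitz condition and robustness replace the corner
    -- direction by that of `x` with vanishing error.
    have h2 : Tendsto (fun i => planeProj (α t x) (phi (B (φ i)) (u (φ i)))) atTop (𝓝 y) := by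
      rw [Metric.tendsto_atTop']
      intro ε hε
      have hdist : Tendsto (fun i => δ / 4 * dist (corner (B (φ i))) x) atTop (𝓝 0) := by
        have := (tendsto_iff_dist_tendsto_zero.1 hcorner).const_mul (δ / 4)
        rwa [mul_zero] at this
      obtain ⟨n, hn⟩ := eventually_atTop.1 (hdist.eventually (gt_mem_nhds hε))
      refine ⟨n, fun i hi => ?_⟩
      have h3 := hα.lipschitz t _ (corner_mem_unitCube hM1 (B (φ i))) x hx
      have h4 : frameDist (α t (corner (B (φ i)))) (α t x) < c * ε := by
        refine lt_of_le_of_lt h3 ?_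
        have := mul_lt_mul_of_pos_left (hn i hi.le) hc.1
        linarith
      have h5 := hc.2 _ (hα.mem t _ (corner_mem_unitCube hM1 (B (φ i)))) _ hxJ ε hε h4 _
        (phi_mem_unitCube hM1 (B (φ i)) (hu (φ i)))
      rw [hy] at h5
      rwa [dist_comm, dist_eq_norm]
    exact tendsto_nhds_unique h1 h2

/-- The pairs of a parameter and a point for which a cube is relevant. -/
def relevant (α : T → Space (k + m) → Frame (k + m) k) (I₂ : Set (Space k)) (r : ℕ)
    (v : Block (k + m) M r) : Set (T × Space k) :=
  {x | psi (α x.1 (corner v.2)) v.2 x.2 ∈ I₂}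

open Classical in
/-- The successors of a cube that are well inside the relevant ones. -/
noncomputable def successors (α : T → Space (k + m) → Frame (k + m) k) (I₁ : Set (Space k)) (r : ℕ)
    (x : T × Space k) (v : Block (k + m) M r) : Finset (Block (k + m) M r) :=
  (Finset.univ.filter fun D : Word (k + m) M r =>
    psi (α x.1 (corner v.2)) D (psi (α x.1 (corner v.2)) v.2 x.2) ∈ I₁).image (Block.child v.2)

/-- Nearby parameters and points share the successors. -/
theorem mem_relevant_of_mem_successors (hM : 2 ≤ M) (hJ : J ⊆ chart k m)
    (hc : IsRobustnessConst J c) (hδ : 0 < gap I₁ I₂)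
    (hα : IsAlmostLinear M J c (gap I₁ I₂) r S α) {n : ℕ}
    {t s : T} (hts : ∀ A : Word (k + m) M (n * r), ∀ x ∈ cube A, ∀ y ∈ cube A,
      frameDist (α t x) (α s y) ≤ c * ((M : ℝ) ^ ((n + 1) * r))⁻¹ * gap I₁ I₂ / 4)
    {y y' : Space k} (hy : dist y y' < ((M : ℝ) ^ ((n + 1) * r))⁻¹ * (gap I₁ I₂ / 2))
    {v w : Block (k + m) M r} (hv : v.1 = n) (hw : w ∈ successors α I₁ r (t, y) v) :
    (s, y') ∈ relevant α I₂ r w := by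
  classical
  have hM1 : 1 ≤ M := by omega
  obtain ⟨n', A⟩ := v
  obtain rfl : n' = n := hv
  obtain ⟨D, hD, rfl⟩ := Finset.mem_image.1 hw
  replace hD := (Finset.mem_filter.1 hD).2
  simp only at hD
  set W := join (succ_mul_eq n' r) A D with hW
  set q : ℝ := (M : ℝ) ^ ((n' + 1) * r) with hq
  have hq0 : 0 < q := by
    have : (0 : ℝ) < M := by exact_mod_cast (by omega : 0 < M)
    positivity
  have hAm := hα.mem t _ (corner_mem_unitCube hM1 A)
  have hWm := hα.mem s _ (corner_mem_unitCube hM1 W)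
  rw [← psi_join hM1 (hJ hAm) (succ_mul_eq n' r), ← hW] at hD
  change psi (α s (corner W)) W y' ∈ I₂
  refine mem_of_dist_lt_gap hD ?_
  have h1 := hts A _ (corner_mem_cube A) _ (cube_join_subset hM1 _ A D (corner_mem_cube W))
  have h2 : ‖planeProj (α t (corner A)) (corner W) - planeProj (α s (corner W)) (corner W)‖ <
      q⁻¹ * (gap I₁ I₂ / 2) := by
    refine hc.2 _ hAm _ hWm _ (by positivity) (lt_of_le_of_lt h1 ?_) _ (corner_mem_unitCube hM1 W)
    have : 0 < c * (q⁻¹ * gap I₁ I₂) := mul_pos hc.1 (by positivity)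
    linarith
  rw [dist_eq_norm] at hy ⊢
  -- After magnification by `q`, the change of direction and the change of point each cost less than
  -- half the collar.
  have h3 : psi (α t (corner A)) W y - psi (α s (corner W)) W y' =
      q • ((y - y') -
        (planeProj (α t (corner A)) (corner W) - planeProj (α s (corner W)) (corner W))) := by
    rw [psi, psi, ← smul_sub]
    congr 1
    abel
  rw [h3, norm_smul, Real.norm_of_nonneg hq0.le]
  calc q * ‖_‖ ≤ q * (‖y - y'‖ +
        ‖planeProj (α t (corner A)) (corner W) - planeProj (α s (corner W)) (corner W)‖) :=
        mul_le_mul_of_nonneg_left (norm_sub_le _ _) hq0.le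
    _ < q * (q⁻¹ * (gap I₁ I₂ / 2) + q⁻¹ * (gap I₁ I₂ / 2)) :=
        mul_lt_mul_of_pos_left (add_lt_add hy h2) hq0
    _ = gap I₁ I₂ := by
        field_simp
        ring

/-- The pairs that are followed below a cube `A`: the points are those for which `A` is relevant
with the parameter `t`; the parameters are only `t` at first, and, from twice the level of `A`
on, all those in the class of `t`. -/
def followed {N : ℕ → ℕ} (α : T → Space (k + m) → Frame (k + m) k) (I₂ : Set (Space k)) (r : ℕ)
    (Z : ∀ n, T → Fin (N n)) (t : T) (A : Block (k + m) M r) (j : ℕ) : Set (T × Space k) :=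
  {x | (t, x.2) ∈ relevant α I₂ r A ∧ (x.1 = t ∨ (A.1 < j ∧ Z (2 * A.1) x.1 = Z (2 * A.1) t))}

/-- Finitely many representatives of the classes that are met by a set. -/
theorem exists_representatives {N : ℕ} (Z : T → Fin N) (R : Set T) :
    ∃ F : Finset T, ↑F ⊆ R ∧ F.card ≤ N ∧ ∀ s ∈ R, ∃ t ∈ F, Z t = Z s := by
  classical
  set H : Finset (Fin N) := Finset.univ.filter fun z => ∃ s ∈ R, Z s = z with hH
  have h : ∀ z : H, ∃ s ∈ R, Z s = z := fun z => (Finset.mem_filter.1 z.2).2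
  choose f hf hZ using h
  refine ⟨Finset.univ.image f, ?_, ?_, ?_⟩
  · intro s hs
    obtain ⟨z, -, rfl⟩ := Finset.mem_image.1 (Finset.mem_coe.1 hs)
    exact hf z
  · refine Finset.card_image_le.trans ?_
    rw [Finset.card_univ, Fintype.card_coe]
    exact (Finset.card_filter_le _ _).trans (by simp)
  · intro s hs
    have hz : Z s ∈ H := Finset.mem_filter.2 ⟨Finset.mem_univ _, s, hs, rfl⟩
    exact ⟨f ⟨Z s, hz⟩, Finset.mem_image_of_mem _ (Finset.mem_univ _), hZ ⟨Z s, hz⟩⟩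

/-- The watched pairs are a net of points times one parameter per class. Up to generation `A.1` the
only parameter is `t`; later there are at most `C * b ^ (A.1 + j) ≤ C * b ^ (2 * j)` classes, a
bound independent of `A`. -/
theorem inherits_followed {Ω : Type*} [MeasurableSpace Ω] {μ : Measure Ω}
    {𝒯 : BranchingTree μ (Block (k + m) M r)} (hlvl : ∀ v, 𝒯.lvl v = v.1)
    (hM : 2 ≤ M) (hJ : J ⊆ chart k m)
    (hc : IsRobustnessConst J c) (hδ : 0 < gap I₁ I₂)
    (hα : IsAlmostLinear M J c (gap I₁ I₂) r S α) {C b : ℕ} (Z : ∀ n, T → Fin (C * b ^ n))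
    (hZ : ∀ n t s, Z n t = Z n s →
      ∀ A : Word (k + m) M (n * r), ∀ x ∈ cube A, ∀ y ∈ cube A,
      frameDist (α t x) (α s y) ≤ c * ((M : ℝ) ^ ((n + 1) * r))⁻¹ * gap I₁ I₂ / 4)
    {G Γ : ℕ} (hnet : ∀ j : ℕ, ∃ E : Finset (Space k), ↑E ⊆ I₂ ∧ E.card ≤ G * Γ ^ j ∧
      ∀ y ∈ I₂, ∃ e ∈ E, dist y e <
        ((M : ℝ) ^ r)⁻¹ * (gap I₁ I₂ / 2) / ((M ^ r : ℕ) : ℝ) ^ j)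
    (t : T) (A : Block (k + m) M r) :
    𝒯.Inherits (relevant α I₂ r) (successors α I₁ r) A (followed α I₂ r Z t A)
      (((C + 1) * G : ℕ) : ℝ) ((((b + 1) ^ 2) * Γ : ℕ) : ℝ) := by
  classical
  have hM1 : 1 ≤ M := by omega
  have hM0 : (0 : ℝ) < M := by exact_mod_cast (by omega : 0 < M)
  refine ⟨?_, fun j => ?_⟩
  · rintro ⟨s, y⟩ ⟨h1, rfl | ⟨h2, -⟩⟩
    · exact h1
    · exact absurd h2 (Nat.not_lt_zero _)
  set Tset : ℕ → Set T := fun j => {s | s = t ∨ (A.1 < j ∧ Z (2 * A.1) s = Z (2 * A.1) t)} with hTset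
  obtain ⟨R, hRsub, hRcard, hR⟩ : ∃ R : Finset T, ↑R ⊆ Tset j ∧ R.card ≤ (C + 1) * ((b + 1) ^ 2) ^ j ∧
      ∀ s ∈ Tset (j + 1), ∃ t' ∈ R, Z (A.1 + j) t' = Z (A.1 + j) s := by
    -- At `j = A.1` the parameter `t` alone represents the enlarged family of generation `j + 1`, as
    -- `A.1 + j = 2 * A.1`. Using `C + 1` and `b + 1` keeps the bound at least `1`.
    rcases le_or_gt j A.1 with hj | hj
    · refine ⟨{t}, by simp [hTset], ?_, ?_⟩
      · rw [Finset.card_singleton]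
        exact Nat.one_le_iff_ne_zero.2 (by positivity)
      · rintro s (rfl | ⟨h1, h2⟩)
        · exact ⟨s, by simp, rfl⟩
        · have h3 : A.1 + j = 2 * A.1 := by omega
          rw [h3]
          exact ⟨t, by simp, h2.symm⟩
    · obtain ⟨R, h1, h2, h3⟩ := exists_representatives (Z (A.1 + j)) (Tset j)
      refine ⟨R, h1, h2.trans ?_, fun s hs => h3 s ?_⟩
      · rw [← pow_mul]
        refine Nat.mul_le_mul (Nat.le_succ C) ?_
        exact (Nat.pow_le_pow_left (Nat.le_succ b) _).trans
          (Nat.pow_le_pow_right (Nat.succ_pos b) (by omega))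
      · rcases hs with rfl | ⟨-, h⟩
        · exact Or.inl rfl
        · exact Or.inr ⟨hj, h⟩
  obtain ⟨E, hEsub, hEcard, hE⟩ := hnet j
  set a := α t (corner A.2) with ha
  -- `pt` inverts `psi a A.2`: it carries the net of `I₂` to the points to which `A` is relevant,
  -- shrinking distances by `M ^ (A.1 * r)`.
  set pt : Space k → Space k := fun e => ((M : ℝ) ^ (A.1 * r))⁻¹ • e + planeProj a (corner A.2)
    with hpt
  refine ⟨R ×ˢ E.image pt, ?_, ?_, ?_⟩
  · rintro ⟨s, y⟩ hs
    rw [Finset.mem_coe, Finset.mem_product, Finset.mem_image] at hs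
    obtain ⟨h1, e, he, rfl⟩ := hs
    refine ⟨?_, hRsub h1⟩
    change psi a A.2 (pt e) ∈ I₂
    rw [psi_inv hM1]
    exact hEsub he
  · rw [Finset.card_product]
    have h1 : R.card * (E.image pt).card ≤ ((C + 1) * ((b + 1) ^ 2) ^ j) * (G * Γ ^ j) :=
      Nat.mul_le_mul hRcard (Finset.card_image_le.trans hEcard)
    have h2 : ((C + 1) * ((b + 1) ^ 2) ^ j) * (G * Γ ^ j) =
        ((C + 1) * G) * (((b + 1) ^ 2) * Γ) ^ j := by
      rw [mul_pow]
      ring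
    rw [h2] at h1
    exact_mod_cast h1
  · rintro ⟨s, y'⟩ ⟨hy', hs⟩
    obtain ⟨t', ht', hZt⟩ := hR s hs
    obtain ⟨e, he, hdist⟩ := hE _ hy'
    refine ⟨(t', pt e), Finset.mk_mem_product ht' (Finset.mem_image_of_mem _ he), ?_⟩
    intro v hv _ w hw
    have hvl : v.1 = A.1 + j := by
      rw [← hlvl, 𝒯.lvl_of_mem_desc hv, hlvl]
    refine mem_relevant_of_mem_successors hM hJ hc hδ hα (hZ _ _ _ hZt) ?_ hvl hw
    have h1 : y' = pt (psi a A.2 y') := by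
      simp only [hpt, psi]
      rw [inv_smul_smul₀ (by positivity), sub_add_cancel]
    have h2 : dist (pt e) y' = ((M : ℝ) ^ (A.1 * r))⁻¹ * dist (psi a A.2 y') e := by
      conv_lhs => rw [h1]
      simp only [hpt]
      rw [dist_add_right, dist_smul₀, Real.norm_of_nonneg (by positivity), dist_comm]
    rw [h2]
    refine (mul_lt_mul_of_pos_left hdist (by positivity)).trans_eq ?_
    have h3 : (M : ℝ) ^ ((A.1 + j + 1) * r) =
        (M : ℝ) ^ (A.1 * r) * (M : ℝ) ^ r * ((M : ℝ) ^ r) ^ j := by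
      rw [← pow_mul, ← pow_add, ← pow_add]
      ring_nf
    rw [h3]
    push_cast
    field_simp

end FractalPercolation

end

/-! ### Conclusion: projections with nonempty interior -/

theorem mainTheorem3 {Ω : Type*} [MeasurableSpace Ω] (μ : MeasureTheory.Measure Ω)
    [MeasureTheory.IsProbabilityMeasure μ]
    (k m M : ℕ) (hk : 1 ≤ k) (hm : 1 ≤ m) (hM : 2 ≤ M)
    (p : (Fin (k + m) → Fin M) → ℝ) (hp : ∀ C, 0 < p C ∧ p C < 1)
    (keep : (Σ n : ℕ, FractalPercolation.Word (k + m) M (n + 1)) → Set Ω)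
    (hkeep : FractalPercolation.IsPercolation μ p keep)
    (I₁ I₂ : Set (FractalPercolation.Space k)) (hI₁ : IsCompact I₁) (hI₂ : IsCompact I₂)
    (hne : I₂.Nonempty) (r : ℕ) (hr : 1 ≤ r)
    (J : Set (FractalPercolation.Frame (k + m) k)) (hJ : J ⊆ FractalPercolation.chart k m)
    (hA : ∀ a ∈ J, FractalPercolation.ConditionA p I₁ I₂ r a)
    (c : ℝ) (hc : FractalPercolation.IsRobustnessConst J c)
    {T : Type*}
    (S : T → FractalPercolation.Space (k + m) → FractalPercolation.Space k)
    (hS : ∃ α : T → FractalPercolation.Space (k + m) → FractalPercolation.Frame (k + m) k,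
      FractalPercolation.IsAlmostLinear M J c (FractalPercolation.gap I₁ I₂) r S α) :
    ∀ᵐ ω ∂μ, (FractalPercolation.limitSet keep ω).Nonempty →
      ∀ t : T, (interior (S t '' FractalPercolation.limitSet keep ω)).Nonempty := by
  classical
  obtain ⟨α, hα⟩ := hS
  rcases isEmpty_or_nonempty T with hT | ⟨⟨t₀⟩⟩
  · exact Filter.Eventually.of_forall fun ω _ t => hT.elim t
  have hM1 : 1 ≤ M := by omega
  have hp0 : ∀ C, 0 ≤ p C := fun C => (hp C).1.le
  have ha₀ := hα.mem t₀ 0 (FractalPercolation.zero_mem_unitCube _)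
  have hne₁ : I₁.Nonempty := (hA _ ha₀).nonempty hM1 (hJ ha₀) hp0 hne
  have hδ := FractalPercolation.gap_pos hk hI₁ hI₂ hne₁ (hA _ ha₀).subset₁
  have : Nonempty (Fin M) := ⟨⟨0, by omega⟩⟩
  obtain ⟨C₀, hC₀⟩ := Finite.exists_min p
  set 𝒯 := FractalPercolation.blockTree hr hkeep (p C₀) (hp C₀).1 (hp C₀).2.le hC₀ with h𝒯
  obtain ⟨C, b, hpart⟩ := hα.partition
  choose Z hZ using hpart
  have hM0 : (0 : ℝ) < M := by exact_mod_cast (by omega : 0 < M)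
  obtain ⟨G, Γ, hnet⟩ := FractalPercolation.exists_nets hI₂
    (ρ := ((M : ℝ) ^ r)⁻¹ * (FractalPercolation.gap I₁ I₂ / 2)) (by positivity) (M ^ r)
    (Nat.one_le_pow _ _ hM1)
  -- A cube of level `n` eventually follows a whole class of `Z (2 * n)`, so these are the classes
  -- to represent.
  have hreps : ∀ n, ∃ F : Finset T, F.card ≤ C * b ^ (2 * n) ∧
      ∀ s, ∃ t ∈ F, Z (2 * n) t = Z (2 * n) s := by
    intro n
    obtain ⟨F, -, h1, h2⟩ := FractalPercolation.exists_representatives (Z (2 * n)) Set.univ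
    exact ⟨F, h1, fun s => h2 s trivial⟩
  choose reps hreps_card hreps using hreps
  have hCh : ∀ x v, x ∈ FractalPercolation.relevant α I₂ r v →
      FractalPercolation.successors α I₁ r x v ⊆ 𝒯.children v ∧
      2 ≤ ∑ w ∈ FractalPercolation.successors α I₁ r x v, μ.real (𝒯.keep w) := by
    rintro ⟨t, y⟩ ⟨n, A⟩ hx
    have haJ := hα.mem t _ (FractalPercolation.corner_mem_unitCube hM1 A)
    constructor
    · intro w hw
      obtain ⟨D, -, rfl⟩ := Finset.mem_image.1 hw
      exact 𝒯.mem_children.2 ⟨rfl, FractalPercolation.Block.par_child A D⟩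
    · rw [FractalPercolation.successors,
        Finset.sum_image fun _ _ _ _ h => FractalPercolation.Block.child_injective A h]
      have h1 : ∀ D : FractalPercolation.Word (k + m) M r,
          μ.real (𝒯.keep (FractalPercolation.Block.child A D)) = ∏ j, p (D j) :=
        FractalPercolation.Block.measure_keepAll hkeep hp0 A
      simp only [h1]
      exact (hA _ haJ).two_le_sum hM1 (hJ haJ) hp0 hx
  have hfne : ∀ t (A : FractalPercolation.Block (k + m) M r) j, (FractalPercolation.followed α I₂ r Z t A j).Nonempty := by
    intro t A j
    obtain ⟨e, he⟩ := hne
    set a := α t (FractalPercolation.corner A.2) with ha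
    refine ⟨(t, ((M : ℝ) ^ (A.1 * r))⁻¹ • e +
      FractalPercolation.planeProj a (FractalPercolation.corner A.2)), ?_, Or.inl rfl⟩
    change FractalPercolation.psi a A.2 _ ∈ I₂
    rw [FractalPercolation.psi_inv hM1]
    exact he
  have main := 𝒯.ae_exists_allTasks (FractalPercolation.Block.root (k + m) M r) rfl _ _
    (FractalPercolation.relevant α I₂ r) (FractalPercolation.successors α I₁ r) hCh
    (fun t A => FractalPercolation.followed α I₂ r Z t A)
    (fun t A => FractalPercolation.inherits_followed (fun _ => rfl) hM hJ hc hδ hα Z hZ hnet t A)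
    hfne t₀ reps C ((b : ℝ) ^ 2) (fun n => by
      rw [← pow_mul]
      exact_mod_cast hreps_card n)
  filter_upwards [main] with ω hω hE t
  obtain ⟨x₀, hx₀⟩ := hE
  obtain ⟨n, hn⟩ := hω (FractalPercolation.alive_nonempty_of_retained hr hkeep _ _ _ _ ω fun n => by
    obtain ⟨A, hA, -⟩ := Set.mem_iUnion₂.1 (Set.mem_iInter.1 hx₀ n)
    exact ⟨A, hA⟩)
  obtain ⟨t', ht', hZt⟩ := hreps n t
  obtain ⟨B, hB, hgrowth⟩ := hn t' ht'
  have hBn : B.1 = n :=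
    (𝒯.lvl_of_mem_desc (𝒯.alive_subset_desc _ _ _ hB)).trans (Nat.zero_add n)
  set a := α t' (FractalPercolation.corner B.2) with ha
  have hsub : FractalPercolation.psi a B.2 ⁻¹' (interior I₂) ⊆
      S t '' FractalPercolation.limitSet keep ω := by
    intro y hy
    -- From generation `n + 1` below `B` on, the whole class of `t'` is followed, and `t` with it;
    -- hence the level `n + (n + 1)`.
    refine FractalPercolation.mem_image_limitSet hM hr hJ hc hα
      (fun a ha => (hA a ha).subset₂.trans interior_subset) keep ω t y (n + (n + 1))
      fun N hN => ?_
    obtain ⟨j, rfl⟩ : ∃ j, N = n + j := ⟨N - n, by omega⟩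
    have h1 : (t, y) ∈ FractalPercolation.followed α I₂ r Z t' B j :=
      ⟨show FractalPercolation.psi a B.2 y ∈ I₂ from interior_subset hy, Or.inr ⟨by omega, by rw [hBn]; exact hZt.symm⟩⟩
    have h2 := hgrowth j _ h1
    have h3 : 0 < (𝒯.hits (FractalPercolation.relevant α I₂ r) B ω j (t, y)).card := by
      have : (0 : ℝ) < (3 / 2 : ℝ) ^ j := by positivity
      exact_mod_cast this.trans_le h2
    obtain ⟨v, hv⟩ := Finset.card_pos.1 h3
    obtain ⟨hv, hrel⟩ := 𝒯.mem_hits.1 hv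
    have hv' := 𝒯.alive_add hB hv
    have hvn : v.1 = n + j :=
      (𝒯.lvl_of_mem_desc (𝒯.alive_subset_desc _ _ _ hv')).trans (Nat.zero_add _)
    obtain ⟨N', W⟩ := v
    obtain rfl : N' = n + j := hvn
    exact ⟨W, (FractalPercolation.mem_alive_blockTree_iff hr hkeep _ _ _ _ ω W).1 hv', hrel⟩
  have hopen : IsOpen (FractalPercolation.psi a B.2 ⁻¹' (interior I₂)) :=
    isOpen_interior.preimage (FractalPercolation.continuous_psi a B.2)
  obtain ⟨e, he⟩ := hne₁
  refine ⟨_, interior_maximal hsub hopen (?_ : ((M : ℝ) ^ (B.1 * r))⁻¹ • e +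
    FractalPercolation.planeProj a (FractalPercolation.corner B.2) ∈ _)⟩
  rw [Set.mem_preimage, FractalPercolation.psi_inv hM1]
  exact (hA _ ha₀).subset₁ he
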